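/- An *alignment* is a pair $(R,t)$ of a rotation matrix $R\in\mathbb{R}^{2\times 2}$ ($R^TR=I$, $\det R=1$) and a vector $t\in\mathbb{R}^2$. For a point $q$ and a line $\ell$ in the plane, $\mathrm{dist}(q,\ell)=\min_{x\in\ell}\|q-x\|_2$. Let $J=\begin{pmatrix}0&-1\\1&0\end{pmatrix}$. **Z-Configs.** For $w=(w_x,w_y)$ with $w_y\ne 0$ and $p,q,z\in\mathbb{R}^2$ put $r_1=\|p-q\|$, $r_2=\|p-z\|$, $r_3=\|q-z\|$, $P=r_1\begin{pmatrix}w_x/w_y&1\\0&0\end{pmatrix}$, $Q=P^T$. If $p\ne q$, put $d_1=\frac{r_1^2+r_2^2-r_3^2}{2r_1}$, $d_2=\sqrt{|r_2^2-d_1^2|}$, $\beta=1$ if $(z-p)^TJ(q-p)>0$ and $\beta=-1$ otherwise, and $Z=P+\frac{d_1}{r_1}(Q-P)+\beta\frac{d_2}{r_1}J(Q-P)$. If $p=q$, put $Z=r_2I$. The result is $(P,Q,Z)$. **Align.** The input is $A=((p_1,\ell_1),\dots,(p_n,\ell_n))$, where each $p_i$ is a point and each $\ell_i$ a line in the plane.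 Write $\ell_i=\{q: v_i^Tq=b_i\}$ with $\|v_i\|=1$ and $b_i\ge 0$, and let $u_i=-Jv_i$, a unit direction vector of $\ell_i$. For all $j,k,l\in\{1,\dots,n\}$ with $j\ne k$: * If $|v_j^Tv_k|\neq 1$, let $R_j$ be the rotation matrix with rows $u_j^T$, $v_j^T$, let $(P',Q',Z')$ be the result of Z-Configs on $(R_ju_k,p_j,p_k,p_l)$, let $(P,Q,Z)=(R_j^TP',R_j^TQ',R_j^TZ')$, let $s$ be the common point of $\ell_j$ and $\ell_k$, $c_l=b_l-v_l^Ts$, and $X=\arg\min_{\|x\|=1}|v_l^TZx-c_l|$. Let $F$ be the set of alignments $(R,t)$ for which some $x\in X$ satisfies $Rp_j-t=s+Px$, $Rp_k-t=s+Qx$ and $Rp_l-t=s+Zx$. If $F$ is finite, all its elements are chosen, otherwise one arbitrary element of it. * If $|v_j^Tv_k|=1$, let $F$ be the set of alignments $(R,t)$ that minimize $\mathrm{dist}(Rp_k-t,\ell_k)$ among the alignments with $Rp_j-t\in\ell_j$. If only finitely many rotations occur in $F$, one arbitrary $(R,t)\in F$ is chosen for each of these rotations $R$; otherwise one arbitrary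 element of $F$ is chosen. The output of Align$(A)$ is the set $C$ of all the chosen alignments. **Lemma.** Let $n\ge 3$ and let $C$ be an output of Align$(A)$ on $n$ point–line pairs. Then for every alignment $(R^*,t^*)$ there is $(R,t)\in C$ such that $$\mathrm{dist}(Rp_i-t,\ell_i)\le 16\cdot\mathrm{dist}(R^*p_i-t^*,\ell_i)\qquad\text{for every } i\in\{1,\dots,n\}.$$ Moreover $|C|\in O(n^3)$, and an output of Align$(A)$ can be computed in $O(n^3)$ time: there are an absolute constant $K$ and one program of a real RAM (unit-cost $+,-$ and comparison of integers; unit-cost $+,-,\times,/,\sqrt{\ }$ and comparison of real numbers; indirect addressing) such that always $|C|\le Kn^3$, and for all $n\ge 3$ and every such $A$, given by the coordinates of the $p_i$ and the coefficients of an equation of each $\ell_i$, the program halts after at most $Kn^3$ steps with a list of the elements of an output of Align$(A)$. -/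

import Mathlib

open scoped Matrix

noncomputable section

namespace PointsToLines

/-! ### Geometry of the plane -/

/-- The Euclidean plane. -/
abbrev Plane : Type := EuclideanSpace ℝ (Fin 2)

/-- A line in the plane. -/
def IsLine (ℓ : AffineSubspace ℝ Plane) : Prop :=
  Module.finrank ℝ ℓ.direction = 1

/-- The matrix-vector product, as a map of the Euclidean plane. -/
def act (M : Matrix (Fin 2) (Fin 2) ℝ) (x : Plane) : Plane :=
  WithLp.toLp 2 (M *ᵥ WithLp.ofLp x)

/-- An alignment `(R, t)`: a rotation matrix (orthogonal, of determinant `1`) and a translation. -/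
abbrev Alignment : Type := Matrix.specialOrthogonalGroup (Fin 2) ℝ × Plane

/-- The image `R p - t` of the point `p` under the alignment `(R, t)`. -/
def Alignment.app (a : Alignment) (p : Plane) : Plane :=
  act (a.1 : Matrix (Fin 2) (Fin 2) ℝ) p - a.2

/-- The Euclidean distance from a point to a line. -/
def lineDist (q : Plane) (ℓ : AffineSubspace ℝ Plane) : ℝ :=
  Metric.infDist q (ℓ : Set Plane)

/-- The rotation by `π / 2` counter-clockwise. -/
def J : Matrix (Fin 2) (Fin 2) ℝ := !![0, -1; 1, 0]

/-! ### The sub-routine Z-Configs -/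

/-- `zConfigs w p q z = (P, Q, Z)` for a direction `w` that is not horizontal. As `x` runs over the
unit vectors, `(P x, Q x, Z x)` runs over the images of the triangle `(p, q, z)` under a rotation
and a translation that take `p` to the horizontal axis and `q` to the line spanned by `w`.
If `p = q`, both are taken to the origin, and `z` runs over a circle. -/
def zConfigs (w p q z : Plane) :
    Matrix (Fin 2) (Fin 2) ℝ × Matrix (Fin 2) (Fin 2) ℝ × Matrix (Fin 2) (Fin 2) ℝ :=
  let r₁ := ‖p - q‖
  let r₂ := ‖p - z‖
  let r₃ := ‖q - z‖
  let d₁ := (r₁ ^ 2 + r₂ ^ 2 - r₃ ^ 2) / (2 * r₁)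
  let d₂ := Real.sqrt |r₂ ^ 2 - d₁ ^ 2|
  let P : Matrix (Fin 2) (Fin 2) ℝ := r₁ • !![w 0 / w 1, 1; 0, 0]
  let Q : Matrix (Fin 2) (Fin 2) ℝ := Pᵀ
  let b : ℝ := open Classical in if 0 < inner ℝ (z - p) (act J (q - p)) then 1 else -1
  let Z : Matrix (Fin 2) (Fin 2) ℝ :=
    open Classical in
    if p = q then r₂ • (1 : Matrix (Fin 2) (Fin 2) ℝ)
    else P + (d₁ / r₁) • (Q - P) + (b * (d₂ / r₁)) • (J * (Q - P))
  (P, Q, Z)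

/-! ### The algorithm Align -/

/-- The lines `ℓ i` are written as `{q | ⟪v i, q⟫ = b i}` with a unit normal `v i` and `b i ≥ 0`. -/
def IsNormalForm {n : ℕ} (ℓ : Fin n → AffineSubspace ℝ Plane) (v : Fin n → Plane)
    (b : Fin n → ℝ) : Prop :=
  ∀ i, ‖v i‖ = 1 ∧ 0 ≤ b i ∧ (ℓ i : Set Plane) = {q | inner ℝ (v i) q = b i}

/-- The unit vector `u` with `J u = v`: a direction of a line with unit normal `v`. -/
def dirOf (v : Plane) : Plane := act (-J) v

/-- The rotation matrix with rows `dirOf v` and `v`; it takes the direction of a line with unit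
normal `v` to the horizontal axis. -/
def rotOf (v : Plane) : Matrix (Fin 2) (Fin 2) ℝ :=
  !![dirOf v 0, dirOf v 1; v 0, v 1]

/-- The alignments found for a triple `(j, k, l)` with `ℓ j`, `ℓ k` not parallel: those that take
`(p j, p k, p l)` to `(s + P x, s + Q x, s + Z x)`, where `s` is the common point of `ℓ j`, `ℓ k` and
`x` is a unit vector that minimizes the distance `|⟪v l, s + Z x⟫ - b l|` of `s + Z x` from `ℓ l`. -/
def crossing {n : ℕ} (p : Fin n → Plane) (ℓ : Fin n → AffineSubspace ℝ Plane) (v : Fin n → Plane)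
    (b : Fin n → ℝ) (j k l : Fin n) : Set Alignment :=
  let PQZ := zConfigs (act (rotOf (v j)) (dirOf (v k))) (p j) (p k) (p l)
  let P := (rotOf (v j))ᵀ * PQZ.1
  let Q := (rotOf (v j))ᵀ * PQZ.2.1
  let Z := (rotOf (v j))ᵀ * PQZ.2.2
  {a | ∃ s x : Plane, s ∈ ℓ j ∧ s ∈ ℓ k ∧ ‖x‖ = 1 ∧
    (∀ y : Plane, ‖y‖ = 1 →
      |inner ℝ (v l) (act Z x) - (b l - inner ℝ (v l) s)| ≤
        |inner ℝ (v l) (act Z y) - (b l - inner ℝ (v l) s)|) ∧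
    a.app (p j) = s + act P x ∧ a.app (p k) = s + act Q x ∧ a.app (p l) = s + act Z x}

/-- The alignments for a pair `(j, k)` with parallel lines: among those that put `p j` on `ℓ j`, the
ones that bring `p k` as close to `ℓ k` as possible. -/
def sliding {n : ℕ} (p : Fin n → Plane) (ℓ : Fin n → AffineSubspace ℝ Plane) (j k : Fin n) :
    Set Alignment :=
  {a | a.app (p j) ∈ ℓ j ∧
    ∀ a' : Alignment, a'.app (p j) ∈ ℓ j →
      lineDist (a.app (p k)) (ℓ k) ≤ lineDist (a'.app (p k)) (ℓ k)}

/-- `S` is all of `F` if `F` is finite, and an arbitrary element of `F` otherwise. -/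
def IsSelection (F S : Set Alignment) : Prop :=
  (F.Finite ∧ S = F) ∨ (F.Infinite ∧ ∃ a ∈ F, S = {a})

/-- `S` has one (arbitrary) element of `F` for every rotation that occurs in `F` if these are
finitely many, and is an arbitrary element of `F` otherwise. -/
def IsSelectionPerRotation (F S : Set Alignment) : Prop :=
  ((Prod.fst '' F).Finite ∧ S ⊆ F ∧ ∀ R ∈ Prod.fst '' F, ∃! t : Plane, ((R, t) : Alignment) ∈ S) ∨
    ((Prod.fst '' F).Infinite ∧ ∃ a ∈ F, S = {a})

/-- `C` is a possible output of Align on the pairs `(p i, ℓ i)`: a union over all triples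
`(j, k, l)` with `j ≠ k` of the alignments chosen for that triple. -/
def IsAlignOutput {n : ℕ} (p : Fin n → Plane) (ℓ : Fin n → AffineSubspace ℝ Plane)
    (C : Set Alignment) : Prop :=
  ∃ (v : Fin n → Plane) (b : Fin n → ℝ) (S : Fin n → Fin n → Fin n → Set Alignment),
    IsNormalForm ℓ v b ∧
    (∀ j k l, j ≠ k → |inner ℝ (v j) (v k)| ≠ 1 → IsSelection (crossing p ℓ v b j k l) (S j k l)) ∧
    (∀ j k l, j ≠ k → |inner ℝ (v j) (v k)| = 1 →
      IsSelectionPerRotation (sliding p ℓ j k) (S j k l)) ∧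
    C = {a | ∃ j k l, j ≠ k ∧ a ∈ S j k l}

/-! ### Running time: the real RAM -/

/-- States of the real RAM: integer registers, real registers, and a memory of real cells. -/
structure State where
  nat : ℕ → ℕ
  real : ℕ → ℝ
  mem : ℕ → ℝ

/-- Integer expressions; the difference is truncated at `0`. -/
inductive NExp where
  | const (c : ℕ)
  | var (i : ℕ)
  | add (e f : NExp)
  | sub (e f : NExp)

def NExp.eval (σ : State) : NExp → ℕ
  | .const c => c
  | .var i => σ.nat i
  | .add e f => e.eval σ + f.eval σ
  | .sub e f => e.eval σ - f.eval σ

/-- The number of elementary operations of an evaluation. -/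
def NExp.cost : NExp → ℕ
  | .const _ => 1
  | .var _ => 1
  | .add e f => e.cost + f.cost + 1
  | .sub e f => e.cost + f.cost + 1

/-- Real expressions. `load e` reads the memory cell with address `e`. -/
inductive RExp where
  | const (c : ℤ)
  | var (i : ℕ)
  | load (e : NExp)
  | add (e f : RExp)
  | sub (e f : RExp)
  | mul (e f : RExp)
  | div (e f : RExp)
  | sqrt (e : RExp)

def RExp.eval (σ : State) : RExp → ℝ
  | .const c => c
  | .var i => σ.real i
  | .load e => σ.mem (e.eval σ)
  | .add e f => e.eval σ + f.eval σ
  | .sub e f => e.eval σ - f.eval σ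
  | .mul e f => e.eval σ * f.eval σ
  | .div e f => e.eval σ / f.eval σ
  | .sqrt e => Real.sqrt (e.eval σ)

def RExp.cost : RExp → ℕ
  | .const _ => 1
  | .var _ => 1
  | .load e => e.cost + 1
  | .add e f => e.cost + f.cost + 1
  | .sub e f => e.cost + f.cost + 1
  | .mul e f => e.cost + f.cost + 1
  | .div e f => e.cost + f.cost + 1
  | .sqrt e => e.cost + 1

/-- Tests. -/
inductive BExp where
  | natLt (e f : NExp)
  | realLt (e f : RExp)
  | not (c : BExp)
  | and (c d : BExp)

def BExp.holds (σ : State) : BExp → Prop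
  | .natLt e f => e.eval σ < f.eval σ
  | .realLt e f => e.eval σ < f.eval σ
  | .not c => ¬ c.holds σ
  | .and c d => c.holds σ ∧ d.holds σ

def BExp.cost : BExp → ℕ
  | .natLt e f => e.cost + f.cost + 1
  | .realLt e f => e.cost + f.cost + 1
  | .not c => c.cost + 1
  | .and c d => c.cost + d.cost + 1

/-- Programs of the real RAM. -/
inductive Prog where
  | skip
  | setNat (i : ℕ) (e : NExp)
  | setReal (i : ℕ) (e : RExp)
  | store (addr : NExp) (e : RExp)
  | seq (c d : Prog)
  | cond (t : BExp) (c d : Prog)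
  | loop (t : BExp) (c : Prog)

/-- `Exec c σ k σ'`: the program `c`, started in the state `σ`, halts in the state `σ'` after `k`
elementary steps. `loop t c` repeats `c` as long as the test `t` holds. -/
inductive Exec : Prog → State → ℕ → State → Prop where
  | skip (σ : State) : Exec .skip σ 1 σ
  | setNat (i : ℕ) (e : NExp) (σ : State) :
      Exec (.setNat i e) σ (e.cost + 1) { σ with nat := Function.update σ.nat i (e.eval σ) }
  | setReal (i : ℕ) (e : RExp) (σ : State) :
      Exec (.setReal i e) σ (e.cost + 1) { σ with real := Function.update σ.real i (e.eval σ) }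
  | store (addr : NExp) (e : RExp) (σ : State) :
      Exec (.store addr e) σ (addr.cost + e.cost + 1)
        { σ with mem := Function.update σ.mem (addr.eval σ) (e.eval σ) }
  | seq {c d : Prog} {σ τ υ : State} {k m : ℕ} (h₁ : Exec c σ k τ) (h₂ : Exec d τ m υ) :
      Exec (.seq c d) σ (k + m) υ
  | condTrue {t : BExp} {c d : Prog} {σ τ : State} {k : ℕ} (ht : t.holds σ) (h : Exec c σ k τ) :
      Exec (.cond t c d) σ (t.cost + k) τ
  | condFalse {t : BExp} {c d : Prog} {σ τ : State} {k : ℕ} (ht : ¬ t.holds σ)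
      (h : Exec d σ k τ) : Exec (.cond t c d) σ (t.cost + k) τ
  | loopFalse {t : BExp} {c : Prog} {σ : State} (ht : ¬ t.holds σ) :
      Exec (.loop t c) σ t.cost σ
  | loopTrue {t : BExp} {c : Prog} {σ τ υ : State} {k m : ℕ} (ht : t.holds σ) (h₁ : Exec c σ k τ)
      (h₂ : Exec (.loop t c) τ m υ) : Exec (.loop t c) σ (t.cost + k + m) υ

/-- The state `σ` holds the input `(p i, ℓ i)`, `i < n`: register `0` holds `n`, and five consecutive
cells for every `i` hold the coordinates of `p i` and the coefficients of some equation
`α x + β y = γ` of the line `ℓ i`. Everything else in `σ` is arbitrary. -/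
def HoldsInput {n : ℕ} (σ : State) (p : Fin n → Plane) (ℓ : Fin n → AffineSubspace ℝ Plane) :
    Prop :=
  σ.nat 0 = n ∧ ∀ i : Fin n,
    σ.mem (5 * (i : ℕ)) = p i 0 ∧ σ.mem (5 * (i : ℕ) + 1) = p i 1 ∧
    (ℓ i : Set Plane) = {q | σ.mem (5 * (i : ℕ) + 2) * q 0 + σ.mem (5 * (i : ℕ) + 3) * q 1 =
      σ.mem (5 * (i : ℕ) + 4)}

/-- The state `σ` holds the set `C` as a list: register `0` holds the length of the list, register
`1` its address, and six consecutive cells hold the entries of `R` (by rows) and of `t` for every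
`(R, t)` of the list. -/
def HoldsOutput (σ : State) (C : Set Alignment) : Prop :=
  ∃ a : Fin (σ.nat 0) → Alignment, C = Set.range a ∧ ∀ i : Fin (σ.nat 0),
    σ.mem (σ.nat 1 + 6 * (i : ℕ)) = (a i).1.1 0 0 ∧
    σ.mem (σ.nat 1 + 6 * (i : ℕ) + 1) = (a i).1.1 0 1 ∧
    σ.mem (σ.nat 1 + 6 * (i : ℕ) + 2) = (a i).1.1 1 0 ∧
    σ.mem (σ.nat 1 + 6 * (i : ℕ) + 3) = (a i).1.1 1 1 ∧
    σ.mem (σ.nat 1 + 6 * (i : ℕ) + 4) = (a i).2 0 ∧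
    σ.mem (σ.nat 1 + 6 * (i : ℕ) + 5) = (a i).2 1

end PointsToLines

end

open scoped Matrix

noncomputable section

namespace PointsToLines

/-! ### Coordinates -/

/-! The factor 16 is 2 · 2 · 4, from three successive motions of the given alignment. First,
translate along a normal so that the point closest to its line lands on that line, say for the pair
j; no distance more than doubles (`exists_on_first`). Second, if some line is not parallel to the
j-th one, slide along the j-th line until the first point with a non-parallel line reaches its own
line, say for the pair k; again no distance more than doubles (`exists_on_second`). Third, rotate
while both incidences are kept. The translation is then determined by the rotation x on the unit
circle, and the defect of every pair is an affine function A x₁ + B x₂ - G (`Frame.res_of_eq`). If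
all lines are parallel, the second motion is skipped: sliding changes no defect, so the defects
again depend on x alone (`Frame.res_of_parallel`).

For the rotation, move x to the nearest point y among all minimizers of the nonconstant functions |A
x₁ + B x₂ - G| (`exists_nearest`). By the triangle inequality y is at most twice as far as x from
each minimizer. On the circle such a function is either a nonnegative constant plus a multiple of
the squared distance to its only minimizer (`abs_eq_of_far`), or a multiple of the product of the
distances to its zeros (`sq_eq_of_near`). Either way it grows at most by a factor of 4
(`abs_le_four_mul`). The point y minimizes the function of some index, and the algorithm tries that
index.

That the algorithm chooses such alignments follows from `IsNormalForm.crossing_eq`: the matrices of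
Z-Configs parametrize exactly the alignments that satisfy the two incidences, so its minimization
over unit vectors is a minimization over these alignments. A nonconstant function has at most two
minimizers, and otherwise one alignment is chosen, hence at most 2 alignments per triple.

For the running time, the minimizers have a closed form (`circSol`) in field operations, one kind of
square root argument per case, and comparisons. Three nested loops append two alignments per triple
with j ≠ k; invariants of the RAM (`Inv`) show that the list written is `chosenList`, and
`isAlignOutput_chosenList` shows that it is a legitimate output. -/

theorem act_zero (M : Matrix (Fin 2) (Fin 2) ℝ) (x : Plane) :
    act M x 0 = M 0 0 * x 0 + M 0 1 * x 1 := by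
  simp [act]

theorem act_one (M : Matrix (Fin 2) (Fin 2) ℝ) (x : Plane) :
    act M x 1 = M 1 0 * x 0 + M 1 1 * x 1 := by
  simp [act]

theorem inner_eq (x y : Plane) : inner ℝ x y = x 0 * y 0 + x 1 * y 1 := by
  simp [PiLp.inner_apply, Fin.sum_univ_two, mul_comm]

theorem norm_sq_eq (x : Plane) : ‖x‖ ^ 2 = x 0 ^ 2 + x 1 ^ 2 := by
  rw [EuclideanSpace.real_norm_sq_eq, Fin.sum_univ_two]

theorem norm_eq_one_iff (x : Plane) : ‖x‖ = 1 ↔ x 0 ^ 2 + x 1 ^ 2 = 1 := by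
  rw [← norm_sq_eq]
  constructor
  · intro h; rw [h]; norm_num
  · intro h
    nlinarith [norm_nonneg x]

theorem plane_ext {x y : Plane} (h0 : x 0 = y 0) (h1 : x 1 = y 1) : x = y := by
  ext i
  fin_cases i
  · exact h0
  · exact h1

/-! ### Alignments through the cosine and sine of the angle. -/

namespace Alignment

/-- The cosine of the angle of the rotation. -/
def cos (a : Alignment) : ℝ := a.1.1 0 0

/-- The sine of the angle of the rotation. -/
def sin (a : Alignment) : ℝ := a.1.1 1 0

theorem entries (a : Alignment) :
    a.1.1 1 1 = a.cos ∧ a.1.1 0 1 = -a.sin ∧ a.cos ^ 2 + a.sin ^ 2 = 1 := by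
  have h := a.1.2
  rw [Matrix.mem_specialOrthogonalGroup_iff, Matrix.mem_orthogonalGroup_iff'] at h
  obtain ⟨ho, hd⟩ := h
  rw [Matrix.det_fin_two] at hd
  have e00 := congrFun (congrFun ho 0) 0
  have e01 := congrFun (congrFun ho 0) 1
  have e11 := congrFun (congrFun ho 1) 1
  simp only [Matrix.mul_apply, Fin.sum_univ_two,
    Matrix.transpose_apply, Matrix.one_apply_eq, Matrix.one_apply_ne (zero_ne_one : (0 : Fin 2) ≠ 1)] at e00 e01 e11
  unfold cos sin
  generalize a.1.1 0 0 = p at *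
  generalize a.1.1 0 1 = q at *
  generalize a.1.1 1 0 = r at *
  generalize a.1.1 1 1 = s at *
  refine ⟨?_, ?_, ?_⟩
  · linear_combination p * hd - s * e00 + r * e01
  · linear_combination (-r) * hd - q * e00 + p * e01
  · linear_combination e00

theorem cos_sq_add_sin_sq (a : Alignment) : a.cos ^ 2 + a.sin ^ 2 = 1 := a.entries.2.2

theorem app_zero (a : Alignment) (p : Plane) :
    a.app p 0 = a.cos * p 0 - a.sin * p 1 - a.2 0 := by
  rw [app, PiLp.sub_apply, act_zero, a.entries.2.1]
  simp only [cos, sin]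
  ring

theorem app_one (a : Alignment) (p : Plane) :
    a.app p 1 = a.sin * p 0 + a.cos * p 1 - a.2 1 := by
  rw [app, PiLp.sub_apply, act_one, a.entries.1]
  simp only [sin]

theorem ext_coords {a a' : Alignment} (hc : a.cos = a'.cos) (hs : a.sin = a'.sin)
    (h0 : a.2 0 = a'.2 0) (h1 : a.2 1 = a'.2 1) : a = a' := by
  refine Prod.ext (Subtype.ext ?_) (plane_ext h0 h1)
  ext i j
  have e := a.entries
  have e' := a'.entries
  fin_cases i <;> fin_cases j
  · exact hc
  · exact e.2.1.trans ((congrArg Neg.neg hs).trans e'.2.1.symm)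
  · exact hs
  · exact e.1.trans (hc.trans e'.1.symm)

/-- The alignment with the rotation of cosine `c` and sine `s` and the translation `(t₀, t₁)`. -/
def mk (c s t₀ t₁ : ℝ) (h : c ^ 2 + s ^ 2 = 1) : Alignment :=
  (⟨!![c, -s; s, c], by
    rw [Matrix.mem_specialOrthogonalGroup_iff, Matrix.mem_orthogonalGroup_iff']
    constructor
    · ext i j
      fin_cases i <;> fin_cases j <;>
        simp [Matrix.mul_apply, Fin.sum_univ_two] <;> nlinarith
    · rw [Matrix.det_fin_two]
      simp
      nlinarith⟩, !₂[t₀, t₁])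

@[simp] theorem mk_cos (c s t₀ t₁ : ℝ) (h : c ^ 2 + s ^ 2 = 1) : (mk c s t₀ t₁ h).cos = c := rfl
@[simp] theorem mk_sin (c s t₀ t₁ : ℝ) (h : c ^ 2 + s ^ 2 = 1) : (mk c s t₀ t₁ h).sin = s := rfl
@[simp] theorem mk_snd_zero (c s t₀ t₁ : ℝ) (h : c ^ 2 + s ^ 2 = 1) :
    (mk c s t₀ t₁ h).2 0 = t₀ := rfl
@[simp] theorem mk_snd_one (c s t₀ t₁ : ℝ) (h : c ^ 2 + s ^ 2 = 1) :
    (mk c s t₀ t₁ h).2 1 = t₁ := rfl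

theorem fst_eq_iff (a a' : Alignment) : a.1 = a'.1 ↔ a.cos = a'.cos ∧ a.sin = a'.sin := by
  constructor
  · intro h
    simp only [cos, sin, h, and_self]
  · rintro ⟨hc, hs⟩
    have := ext_coords (a := (a.1, 0)) (a' := (a'.1, 0)) hc hs rfl rfl
    exact (Prod.mk.inj this).1

end Alignment

/-- The rotation is the complex quotient (x' + i y') / (x + i y), of modulus 1; if the denominator
vanishes, so does the numerator, and the identity serves. -/
theorem exists_rotation (x y x' y' : ℝ) (h : x ^ 2 + y ^ 2 = x' ^ 2 + y' ^ 2) :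
    ∃ c s : ℝ, c ^ 2 + s ^ 2 = 1 ∧ c * x - s * y = x' ∧ s * x + c * y = y' := by
  by_cases h0 : x ^ 2 + y ^ 2 = 0
  · have hx : x = 0 := by nlinarith [sq_nonneg x, sq_nonneg y]
    have hy : y = 0 := by nlinarith [sq_nonneg x, sq_nonneg y]
    have hx' : x' = 0 := by nlinarith [sq_nonneg x', sq_nonneg y']
    have hy' : y' = 0 := by nlinarith [sq_nonneg x', sq_nonneg y']
    exact ⟨1, 0, by norm_num, by simp [hx, hx'], by simp [hy, hy']⟩
  · refine ⟨(x * x' + y * y') / (x ^ 2 + y ^ 2), (x * y' - y * x') / (x ^ 2 + y ^ 2), ?_, ?_, ?_⟩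
    · rw [div_pow, div_pow, ← add_div, div_eq_one_iff_eq (pow_ne_zero 2 h0)]
      linear_combination (-(x ^ 2 + y ^ 2)) * h
    · field_simp
      ring
    · field_simp
      ring

/-! ### Points with equations of lines -/

/-- The point `(x, y)` together with the equation `α X + β Y = γ`. -/
structure Datum where
  x : ℝ
  y : ℝ
  α : ℝ
  β : ℝ
  γ : ℝ

namespace Datum

/-- The defect of the equation at the image of the point. -/
def res (d : Datum) (a : Alignment) : ℝ :=
  d.α * (a.cos * d.x - a.sin * d.y - a.2 0) + d.β * (a.sin * d.x + a.cos * d.y - a.2 1) - d.γ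

/-- `d` describes the point `p` and the line `ℓ`. -/
def Describes (d : Datum) (p : Plane) (ℓ : AffineSubspace ℝ Plane) : Prop :=
  0 < d.α ^ 2 + d.β ^ 2 ∧ d.x = p 0 ∧ d.y = p 1 ∧
    (ℓ : Set Plane) = {q | d.α * q 0 + d.β * q 1 = d.γ}

end Datum

theorem lineDist_eq {ℓ : AffineSubspace ℝ Plane} {α β γ : ℝ} (h : 0 < α ^ 2 + β ^ 2)
    (hℓ : (ℓ : Set Plane) = {q | α * q 0 + β * q 1 = γ}) (q : Plane) :
    lineDist q ℓ = |α * q 0 + β * q 1 - γ| / √(α ^ 2 + β ^ 2) := by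
  have hs : 0 < √(α ^ 2 + β ^ 2) := Real.sqrt_pos.2 h
  have hs2 : √(α ^ 2 + β ^ 2) ^ 2 = α ^ 2 + β ^ 2 := Real.sq_sqrt h.le
  set e := α * q 0 + β * q 1 - γ with he
  -- The foot of the perpendicular from `q`.
  set y : Plane := !₂[q 0 - e * α / (α ^ 2 + β ^ 2), q 1 - e * β / (α ^ 2 + β ^ 2)] with hy
  have y0 : y 0 = q 0 - e * α / (α ^ 2 + β ^ 2) := rfl
  have y1 : y 1 = q 1 - e * β / (α ^ 2 + β ^ 2) := rfl
  have hyℓ : y ∈ (ℓ : Set Plane) := by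
    rw [hℓ, Set.mem_ofPred_eq, y0, y1]
    field_simp
    rw [he]
    ring
  apply le_antisymm
  · refine (Metric.infDist_le_dist_of_mem hyℓ).trans (le_of_eq ?_)
    rw [← sq_eq_sq₀ dist_nonneg (by positivity), dist_eq_norm, norm_sq_eq, PiLp.sub_apply,
      PiLp.sub_apply, y0, y1, div_pow, sq_abs, hs2]
    field_simp
    ring
  · rw [lineDist, Metric.le_infDist ⟨y, hyℓ⟩]
    intro z hz
    rw [hℓ, Set.mem_ofPred_eq] at hz
    rw [div_le_iff₀ hs, ← sq_le_sq₀ (abs_nonneg _) (by positivity), mul_pow, sq_abs, hs2,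
      dist_eq_norm, norm_sq_eq, PiLp.sub_apply, PiLp.sub_apply]
    have : e = α * (q 0 - z 0) + β * (q 1 - z 1) := by rw [he, ← hz]; ring
    rw [this]
    -- Cauchy–Schwarz; the hint is the defect term of Lagrange's identity.
    nlinarith [sq_nonneg (α * (q 1 - z 1) - β * (q 0 - z 0))]

namespace Datum

variable {d : Datum} {p : Plane} {ℓ : AffineSubspace ℝ Plane}

theorem Describes.mem_iff (h : d.Describes p ℓ) (a : Alignment) :
    a.app p ∈ ℓ ↔ d.res a = 0 := by
  obtain ⟨_, hx, hy, hℓ⟩ := h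
  rw [← SetLike.mem_coe, hℓ, Set.mem_ofPred_eq, a.app_zero, a.app_one, res, hx, hy, sub_eq_zero]

theorem Describes.lineDist_eq (h : d.Describes p ℓ) (a : Alignment) :
    lineDist (a.app p) ℓ = |d.res a| / √(d.α ^ 2 + d.β ^ 2) := by
  obtain ⟨h0, hx, hy, hℓ⟩ := h
  rw [PointsToLines.lineDist_eq h0 hℓ, a.app_zero, a.app_one, res, hx, hy]

theorem Describes.lineDist_le_iff (h : d.Describes p ℓ) (a a' : Alignment) :
    lineDist (a.app p) ℓ ≤ lineDist (a'.app p) ℓ ↔ |d.res a| ≤ |d.res a'| := by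
  rw [h.lineDist_eq, h.lineDist_eq, div_le_div_iff_of_pos_right (Real.sqrt_pos.2 h.1)]

/-- The determinant of two normal vectors. -/
def det (d₁ d₂ : Datum) : ℝ := d₁.α * d₂.β - d₂.α * d₁.β

/-- The alignments that take the first two points to their lines and, subject to this, the third
point as close to its line as possible. -/
def crossSet (d₁ d₂ d₃ : Datum) : Set Alignment :=
  {a | d₁.res a = 0 ∧ d₂.res a = 0 ∧
    ∀ a', d₁.res a' = 0 → d₂.res a' = 0 → |d₃.res a| ≤ |d₃.res a'|}

/-- The alignments that take the first point to its line and, subject to this, the second point as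
close to its line as possible. -/
def slideSet (d₁ d₂ : Datum) : Set Alignment :=
  {a | d₁.res a = 0 ∧ ∀ a', d₁.res a' = 0 → |d₂.res a| ≤ |d₂.res a'|}

theorem sliding_eq {n : ℕ} {p : Fin n → Plane} {ℓ : Fin n → AffineSubspace ℝ Plane}
    {D : Fin n → Datum} (hD : ∀ i, (D i).Describes (p i) (ℓ i)) (j k : Fin n) :
    sliding p ℓ j k = slideSet (D j) (D k) := by
  ext a
  simp only [sliding, slideSet, Set.mem_ofPred_eq, (hD j).mem_iff, (hD k).lineDist_le_iff]

end Datum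

/-! ### The configurations of Z-Configs -/

/-- Removes the square root, the absolute value and the sign from Z-Configs. By the law of cosines
d₁ is the component of z - p along q - p, and r₂² - d₁² is the square of the component along J(q -
p). The root is the absolute value of the latter, and β restores its sign; the value β = -1 for a
vanishing component does no harm. -/
theorem zConfigs_snd_snd {w p q z : Plane} (h : p ≠ q) :
    (zConfigs w p q z).2.2 = (zConfigs w p q z).1 +
      (inner ℝ (z - p) (q - p) / ‖p - q‖ ^ 2) •
        ((zConfigs w p q z).2.1 - (zConfigs w p q z).1) +
      (inner ℝ (z - p) (act J (q - p)) / ‖p - q‖ ^ 2) •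
        (J * ((zConfigs w p q z).2.1 - (zConfigs w p q z).1)) := by
  have hr : 0 < ‖p - q‖ := norm_pos_iff.2 (sub_ne_zero.2 h)
  have hr2 : ‖p - q‖ ^ 2 ≠ 0 := by positivity
  have h1 : (‖p - q‖ ^ 2 + ‖p - z‖ ^ 2 - ‖q - z‖ ^ 2) / (2 * ‖p - q‖) =
      inner ℝ (z - p) (q - p) / ‖p - q‖ := by
    rw [div_eq_div_iff (by positivity) hr.ne', norm_sq_eq, norm_sq_eq, norm_sq_eq, inner_eq]
    simp only [PiLp.sub_apply]
    ring
  have h2 : ‖p - z‖ ^ 2 - (inner ℝ (z - p) (q - p) / ‖p - q‖) ^ 2 =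
      (inner ℝ (z - p) (act J (q - p)) / ‖p - q‖) ^ 2 := by
    rw [div_pow, div_pow, sub_eq_iff_eq_add, ← add_div, eq_div_iff hr2, norm_sq_eq, norm_sq_eq,
      inner_eq, inner_eq, act_zero, act_one]
    simp [J]
    ring
  have h3 : (open Classical in if 0 < inner ℝ (z - p) (act J (q - p)) then (1 : ℝ) else -1) *
      |inner ℝ (z - p) (act J (q - p))| = inner ℝ (z - p) (act J (q - p)) := by
    split_ifs with h0
    · rw [abs_of_pos h0, one_mul]
    · rw [abs_of_nonpos (not_lt.1 h0)]; ring
  simp only [zConfigs, if_neg h]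
  rw [h1, h2, abs_of_nonneg (sq_nonneg _), Real.sqrt_sq_eq_abs, abs_div, abs_of_pos hr, div_div,
    div_div, mul_div_assoc', h3, ← sq]

/-- The coordinates of the configuration for lines with unit normals `v` and `v'`, in the frame of
the first line. -/
theorem zConfigs_coords {v v' p q z : Plane} (hv : v 0 ^ 2 + v 1 ^ 2 = 1)
    (hD : v 0 * v' 1 - v' 0 * v 1 ≠ 0) (x : Plane) :
    ∃ m m' : ℝ,
      act ((rotOf v)ᵀ * (zConfigs (act (rotOf v) (dirOf v')) p q z).1) x 0 = m * v 1 ∧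
      act ((rotOf v)ᵀ * (zConfigs (act (rotOf v) (dirOf v')) p q z).1) x 1 = -(m * v 0) ∧
      act ((rotOf v)ᵀ * (zConfigs (act (rotOf v) (dirOf v')) p q z).2.1) x 0 = m' * v' 1 ∧
      act ((rotOf v)ᵀ * (zConfigs (act (rotOf v) (dirOf v')) p q z).2.1) x 1 = -(m' * v' 0) ∧
      m' * v' 1 - m * v 1 = ‖p - q‖ * (v 0 * x 0 - v 1 * x 1) ∧
      -(m' * v' 0) + m * v 0 = ‖p - q‖ * (v 1 * x 0 + v 0 * x 1) ∧
      (p ≠ q →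
        act ((rotOf v)ᵀ * (zConfigs (act (rotOf v) (dirOf v')) p q z).2.2) x 0 = m * v 1 +
          inner ℝ (z - p) (q - p) / ‖p - q‖ ^ 2 * (‖p - q‖ * (v 0 * x 0 - v 1 * x 1)) -
          inner ℝ (z - p) (act J (q - p)) / ‖p - q‖ ^ 2 *
            (‖p - q‖ * (v 1 * x 0 + v 0 * x 1)) ∧
        act ((rotOf v)ᵀ * (zConfigs (act (rotOf v) (dirOf v')) p q z).2.2) x 1 = -(m * v 0) +
          inner ℝ (z - p) (q - p) / ‖p - q‖ ^ 2 * (‖p - q‖ * (v 1 * x 0 + v 0 * x 1)) +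
          inner ℝ (z - p) (act J (q - p)) / ‖p - q‖ ^ 2 *
            (‖p - q‖ * (v 0 * x 0 - v 1 * x 1))) ∧
      (p = q →
        act ((rotOf v)ᵀ * (zConfigs (act (rotOf v) (dirOf v')) p q z).2.2) x 0 =
          ‖p - z‖ * (v 1 * x 0 + v 0 * x 1) ∧
        act ((rotOf v)ᵀ * (zConfigs (act (rotOf v) (dirOf v')) p q z).2.2) x 1 =
          ‖p - z‖ * (-(v 0 * x 0) + v 1 * x 1)) := by
  have w0 : act (rotOf v) (dirOf v') 0 = v 1 * v' 1 + v 0 * v' 0 := by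
    simp [rotOf, dirOf, act_zero, act_one, J]
  have w1 : act (rotOf v) (dirOf v') 1 = v 0 * v' 1 - v' 0 * v 1 := by
    simp [rotOf, dirOf, act_zero, act_one, J]
    ring
  set w := act (rotOf v) (dirOf v') with hw
  set D := v 0 * v' 1 - v' 0 * v 1 with hDdef
  have hP : (zConfigs w p q z).1 = ‖p - q‖ • !![w 0 / w 1, 1; 0, 0] := rfl
  have hQ : (zConfigs w p q z).2.1 = ‖p - q‖ • !![w 0 / w 1, 0; 1, 0] := by
    ext i j
    fin_cases i <;> fin_cases j <;> simp [zConfigs]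
  -- The signed positions of the two points along their lines, measured from the common point. The
  -- second coordinate of `w` is `D`, the sine of the angle between the lines.
  refine ⟨‖p - q‖ * (w 0 / w 1 * x 0 + x 1), ‖p - q‖ * (x 0 / D),
    ?_, ?_, ?_, ?_, ?_, ?_, ?_, ?_⟩
  · rw [act_zero, hP]
    simp [Matrix.mul_apply, Fin.sum_univ_two, rotOf, dirOf, act_zero, act_one, J]
    ring
  · rw [act_one, hP]
    simp [Matrix.mul_apply, Fin.sum_univ_two, rotOf, dirOf, act_zero, act_one, J]
    ring
  · rw [act_zero, hQ]
    simp [Matrix.mul_apply, Fin.sum_univ_two, rotOf, dirOf, act_zero, act_one, J, w0, w1]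
    field_simp
    rw [hDdef]
    linear_combination (‖p - q‖ * x 0 * v' 1) * hv
  · rw [act_one, hQ]
    simp [Matrix.mul_apply, Fin.sum_univ_two, rotOf, dirOf, act_zero, act_one, J, w0, w1]
    field_simp
    rw [hDdef]
    linear_combination (-‖p - q‖ * x 0 * v' 0) * hv
  · rw [w0, w1]
    field_simp
    rw [hDdef]
    linear_combination (-‖p - q‖ * x 0 * v' 1) * hv
  · rw [w0, w1]
    field_simp
    rw [hDdef]
    linear_combination (‖p - q‖ * x 0 * v' 0) * hv
  · intro hpq
    rw [zConfigs_snd_snd hpq, hQ, hP, act_zero, act_one]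
    generalize inner ℝ (z - p) (q - p) / ‖p - q‖ ^ 2 = κ
    generalize inner ℝ (z - p) (act J (q - p)) / ‖p - q‖ ^ 2 = ν
    constructor <;>
    · simp [Matrix.mul_apply, Fin.sum_univ_two, rotOf, dirOf, act_zero, act_one, J]
      ring
  · intro hpq
    have hZ : (zConfigs w p q z).2.2 = ‖p - z‖ • (1 : Matrix (Fin 2) (Fin 2) ℝ) := by
      simp only [zConfigs, if_pos hpq]
    rw [hZ, act_zero, act_one]
    constructor <;>
    · simp [Matrix.mul_apply, Fin.sum_univ_two, rotOf, dirOf, act_zero, act_one, J]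
      ring

theorem eq_zero_of_two_equations {a b a' b' x y : ℝ} (hD : a * b' - a' * b ≠ 0)
    (h : a * x + b * y = 0) (h' : a' * x + b' * y = 0) : x = 0 ∧ y = 0 := by
  constructor
  · have : (a * b' - a' * b) * x = 0 := by linear_combination b' * h - b * h'
    exact (mul_eq_zero.1 this).resolve_left hD
  · have : (a * b' - a' * b) * y = 0 := by linear_combination a * h' - a' * h
    exact (mul_eq_zero.1 this).resolve_left hD

/-- Before the rotation back from the frame of the first line, Q - P is r₁ J, so the image of the
edge q - p determines x. The configuration for this x differs from the true images of p and q by one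
common vector, which is parallel to both lines and therefore zero. If p = q, both points are forced
to the common point, and x is read off from the image of z - p. -/
theorem exists_config {v v' : Plane} (hv : v 0 ^ 2 + v 1 ^ 2 = 1)
    (hD : v 0 * v' 1 - v' 0 * v 1 ≠ 0) {s p q z : Plane} {a : Alignment}
    (hp : v 0 * (a.app p 0 - s 0) + v 1 * (a.app p 1 - s 1) = 0)
    (hq : v' 0 * (a.app q 0 - s 0) + v' 1 * (a.app q 1 - s 1) = 0) :
    ∃ x : Plane, ‖x‖ = 1 ∧
      a.app p = s + act ((rotOf v)ᵀ * (zConfigs (act (rotOf v) (dirOf v')) p q z).1) x ∧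
      a.app q = s + act ((rotOf v)ᵀ * (zConfigs (act (rotOf v) (dirOf v')) p q z).2.1) x ∧
      a.app z = s + act ((rotOf v)ᵀ * (zConfigs (act (rotOf v) (dirOf v')) p q z).2.2) x := by
  have hcs := a.cos_sq_add_sin_sq
  by_cases hpq : p = q
  · obtain ⟨x, hx, hx0, hx1⟩ : ∃ x : Plane, x 0 ^ 2 + x 1 ^ 2 = 1 ∧
        ‖p - z‖ * (v 1 * x 0 + v 0 * x 1) = a.app z 0 - a.app p 0 ∧
        ‖p - z‖ * (-(v 0 * x 0) + v 1 * x 1) = a.app z 1 - a.app p 1 := by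
      have hz : (a.app z 0 - a.app p 0) ^ 2 + (a.app z 1 - a.app p 1) ^ 2 = ‖p - z‖ ^ 2 := by
        rw [norm_sq_eq, a.app_zero, a.app_one, a.app_zero, a.app_one]
        simp only [PiLp.sub_apply]
        linear_combination ((p 0 - z 0) ^ 2 + (p 1 - z 1) ^ 2) * hcs
      -- If all three points coincide, every unit vector serves.
      by_cases hr : ‖p - z‖ = 0
      · rw [hr] at hz
        refine ⟨!₂[1, 0], by simp, ?_, ?_⟩
        · rw [hr]
          nlinarith [sq_nonneg (a.app z 0 - a.app p 0), sq_nonneg (a.app z 1 - a.app p 1)]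
        · rw [hr]
          nlinarith [sq_nonneg (a.app z 0 - a.app p 0), sq_nonneg (a.app z 1 - a.app p 1)]
      · generalize a.app z 0 - a.app p 0 = e₀ at hz ⊢
        generalize a.app z 1 - a.app p 1 = e₁ at hz ⊢
        refine ⟨!₂[(v 1 * e₀ - v 0 * e₁) / ‖p - z‖, (v 0 * e₀ + v 1 * e₁) / ‖p - z‖], ?_, ?_, ?_⟩
        · simp only [Matrix.cons_val_zero, Matrix.cons_val_one]
          rw [div_pow, div_pow, ← add_div, div_eq_one_iff_eq (pow_ne_zero 2 hr), ← hz]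
          linear_combination (e₀ ^ 2 + e₁ ^ 2) * hv
        · simp only [Matrix.cons_val_zero, Matrix.cons_val_one]
          field_simp
          linear_combination e₀ * hv
        · simp only [Matrix.cons_val_zero, Matrix.cons_val_one]
          field_simp
          linear_combination e₁ * hv
    obtain ⟨m, m', hP0, hP1, hQ0, hQ1, hm0, hm1, -, hZ⟩ := zConfigs_coords (z := z)
      (p := p) (q := q) hv hD x
    obtain ⟨hZ0, hZ1⟩ := hZ hpq
    rw [← hpq] at hq
    obtain ⟨hs0, hs1⟩ := eq_zero_of_two_equations hD hp hq
    have hr1 : ‖p - q‖ = 0 := by rw [hpq, sub_self, norm_zero]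
    rw [hr1] at hm0 hm1
    have hmv : v 0 * (m * v 1) + v 1 * (-(m * v 0)) = 0 := by ring
    have hmv' : v' 0 * (m * v 1) + v' 1 * (-(m * v 0)) = 0 := by
      linear_combination (-v' 0) * hm0 - v' 1 * hm1
    obtain ⟨h0, h1⟩ := eq_zero_of_two_equations hD hmv hmv'
    refine ⟨x, (norm_eq_one_iff x).2 hx, plane_ext ?_ ?_, plane_ext ?_ ?_, plane_ext ?_ ?_⟩
    · rw [PiLp.add_apply, hP0]; linarith
    · rw [PiLp.add_apply, hP1]; linarith
    · rw [PiLp.add_apply, hQ0, ← hpq]; linarith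
    · rw [PiLp.add_apply, hQ1, ← hpq]; linarith
    · rw [PiLp.add_apply, hZ0]; linarith
    · rw [PiLp.add_apply, hZ1]; linarith
  · have hr : ‖p - q‖ ≠ 0 := norm_ne_zero_iff.2 (sub_ne_zero.2 hpq)
    have hr2 : ‖p - q‖ ^ 2 = (q 0 - p 0) ^ 2 + (q 1 - p 1) ^ 2 := by
      rw [norm_sq_eq]
      simp only [PiLp.sub_apply]
      ring
    obtain ⟨x, hx, hx0, hx1⟩ : ∃ x : Plane, x 0 ^ 2 + x 1 ^ 2 = 1 ∧
        ‖p - q‖ * (v 0 * x 0 - v 1 * x 1) = a.app q 0 - a.app p 0 ∧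
        ‖p - q‖ * (v 1 * x 0 + v 0 * x 1) = a.app q 1 - a.app p 1 := by
      have hz : (a.app q 0 - a.app p 0) ^ 2 + (a.app q 1 - a.app p 1) ^ 2 = ‖p - q‖ ^ 2 := by
        rw [hr2, a.app_zero, a.app_one, a.app_zero, a.app_one]
        linear_combination ((p 0 - q 0) ^ 2 + (p 1 - q 1) ^ 2) * hcs
      generalize a.app q 0 - a.app p 0 = e₀ at hz ⊢
      generalize a.app q 1 - a.app p 1 = e₁ at hz ⊢
      refine ⟨!₂[(v 0 * e₀ + v 1 * e₁) / ‖p - q‖, (v 0 * e₁ - v 1 * e₀) / ‖p - q‖], ?_, ?_, ?_⟩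
      · simp only [Matrix.cons_val_zero, Matrix.cons_val_one]
        rw [div_pow, div_pow, ← add_div, div_eq_one_iff_eq (pow_ne_zero 2 hr), ← hz]
        linear_combination (e₀ ^ 2 + e₁ ^ 2) * hv
      · simp only [Matrix.cons_val_zero, Matrix.cons_val_one]
        field_simp
        linear_combination e₀ * hv
      · simp only [Matrix.cons_val_zero, Matrix.cons_val_one]
        field_simp
        linear_combination e₁ * hv
    obtain ⟨m, m', hP0, hP1, hQ0, hQ1, hm0, hm1, hZ, -⟩ := zConfigs_coords (z := z)
      (p := p) (q := q) hv hD x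
    obtain ⟨hZ0, hZ1⟩ := hZ hpq
    rw [hx0] at hm0 hZ0 hZ1
    rw [hx1] at hm1 hZ0 hZ1
    have hg : v 0 * (m * v 1 - (a.app p 0 - s 0)) + v 1 * (-(m * v 0) - (a.app p 1 - s 1)) = 0 := by
      linear_combination -hp
    have hg' : v' 0 * (m * v 1 - (a.app p 0 - s 0)) +
        v' 1 * (-(m * v 0) - (a.app p 1 - s 1)) = 0 := by
      linear_combination -hq - v' 0 * hm0 - v' 1 * hm1
    obtain ⟨h0, h1⟩ := eq_zero_of_two_equations hD hg hg'
    refine ⟨x, (norm_eq_one_iff x).2 hx, plane_ext ?_ ?_, plane_ext ?_ ?_, plane_ext ?_ ?_⟩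
    · rw [PiLp.add_apply, hP0]; linarith
    · rw [PiLp.add_apply, hP1]; linarith
    · rw [PiLp.add_apply, hQ0]; linarith
    · rw [PiLp.add_apply, hQ1]; linarith
    · rw [PiLp.add_apply, hZ0, inner_eq, inner_eq, act_zero, act_one]
      have e : m * v 1 = a.app p 0 - s 0 := by linarith
      rw [e, hr2, a.app_zero, a.app_zero, a.app_one, a.app_zero, a.app_one]
      have hne : (q 0 - p 0) ^ 2 + (q 1 - p 1) ^ 2 ≠ 0 := by rw [← hr2]; exact pow_ne_zero 2 hr
      simp only [PiLp.sub_apply, J, Matrix.cons_val_zero, Matrix.cons_val_one, Matrix.of_apply,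
        Matrix.cons_val']
      field_simp
      ring
    · rw [PiLp.add_apply, hZ1, inner_eq, inner_eq, act_zero, act_one]
      have e : -(m * v 0) = a.app p 1 - s 1 := by linarith
      rw [e, hr2, a.app_one, a.app_zero, a.app_one, a.app_zero, a.app_one]
      have hne : (q 0 - p 0) ^ 2 + (q 1 - p 1) ^ 2 ≠ 0 := by rw [← hr2]; exact pow_ne_zero 2 hr
      simp only [PiLp.sub_apply, J, Matrix.cons_val_zero, Matrix.cons_val_one, Matrix.of_apply,
        Matrix.cons_val']
      field_simp
      ring

/-- Converse of `exists_config`: the configuration is a congruent copy of the triangle with the same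
orientation. A rotation matches one nonzero edge, the translation matches p, and z follows because
rotations commute with J. -/
theorem exists_alignment {v v' : Plane} (hv : v 0 ^ 2 + v 1 ^ 2 = 1)
    (hD : v 0 * v' 1 - v' 0 * v 1 ≠ 0) (s p q z : Plane) {x : Plane} (hx : ‖x‖ = 1) :
    ∃ a : Alignment,
      a.app p = s + act ((rotOf v)ᵀ * (zConfigs (act (rotOf v) (dirOf v')) p q z).1) x ∧
      a.app q = s + act ((rotOf v)ᵀ * (zConfigs (act (rotOf v) (dirOf v')) p q z).2.1) x ∧
      a.app z = s + act ((rotOf v)ᵀ * (zConfigs (act (rotOf v) (dirOf v')) p q z).2.2) x := by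
  rw [norm_eq_one_iff] at hx
  obtain ⟨m, m', hP0, hP1, hQ0, hQ1, hm0, hm1, hZ, hZ'⟩ := zConfigs_coords (z := z)
    (p := p) (q := q) hv hD x
  by_cases hpq : p = q
  · subst hpq
    obtain ⟨hZ0, hZ1⟩ := hZ' rfl
    have hr1 : ‖p - p‖ = 0 := by rw [sub_self, norm_zero]
    have hr2 : ‖p - z‖ ^ 2 = (z 0 - p 0) ^ 2 + (z 1 - p 1) ^ 2 := by
      rw [norm_sq_eq]
      simp only [PiLp.sub_apply]
      ring
    rw [hr1] at hm0 hm1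
    have hmv : v 0 * (m * v 1) + v 1 * (-(m * v 0)) = 0 := by ring
    have hmv' : v' 0 * (m * v 1) + v' 1 * (-(m * v 0)) = 0 := by
      linear_combination (-v' 0) * hm0 - v' 1 * hm1
    obtain ⟨h0, h1⟩ := eq_zero_of_two_equations hD hmv hmv'
    obtain ⟨c, w, hcw, hc0, hc1⟩ := exists_rotation (z 0 - p 0) (z 1 - p 1)
      (‖p - z‖ * (v 1 * x 0 + v 0 * x 1)) (‖p - z‖ * (-(v 0 * x 0) + v 1 * x 1)) (by
        rw [← hr2]
        linear_combination (-‖p - z‖ ^ 2 * (x 0 ^ 2 + x 1 ^ 2)) * hv - ‖p - z‖ ^ 2 * hx)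
    refine ⟨Alignment.mk c w (c * p 0 - w * p 1 - s 0) (w * p 0 + c * p 1 - s 1) hcw,
      plane_ext ?_ ?_, plane_ext ?_ ?_, plane_ext ?_ ?_⟩ <;>
      simp only [Alignment.app_zero, Alignment.app_one, PiLp.add_apply, Alignment.mk_cos,
        Alignment.mk_sin, Alignment.mk_snd_zero, Alignment.mk_snd_one, hP0, hP1, hQ0, hQ1, hZ0,
        hZ1] <;> linarith
  · obtain ⟨hZ0, hZ1⟩ := hZ hpq
    have hr : ‖p - q‖ ≠ 0 := norm_ne_zero_iff.2 (sub_ne_zero.2 hpq)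
    have hr2 : ‖p - q‖ ^ 2 = (q 0 - p 0) ^ 2 + (q 1 - p 1) ^ 2 := by
      rw [norm_sq_eq]
      simp only [PiLp.sub_apply]
      ring
    have hne : (q 0 - p 0) ^ 2 + (q 1 - p 1) ^ 2 ≠ 0 := by rw [← hr2]; exact pow_ne_zero 2 hr
    obtain ⟨c, w, hcw, hc0, hc1⟩ := exists_rotation (q 0 - p 0) (q 1 - p 1)
      (‖p - q‖ * (v 0 * x 0 - v 1 * x 1)) (‖p - q‖ * (v 1 * x 0 + v 0 * x 1)) (by
        rw [← hr2]
        linear_combination (-‖p - q‖ ^ 2 * (x 0 ^ 2 + x 1 ^ 2)) * hv - ‖p - q‖ ^ 2 * hx)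
    rw [← hc0, ← hc1] at hZ0 hZ1
    refine ⟨Alignment.mk c w (c * p 0 - w * p 1 - s 0 - m * v 1)
      (w * p 0 + c * p 1 - s 1 + m * v 0) hcw,
      plane_ext ?_ ?_, plane_ext ?_ ?_, plane_ext ?_ ?_⟩ <;>
      simp only [Alignment.app_zero, Alignment.app_one, PiLp.add_apply, Alignment.mk_cos,
        Alignment.mk_sin, Alignment.mk_snd_zero, Alignment.mk_snd_one, hP0, hP1, hQ0, hQ1, hZ0,
        hZ1]
    · ring
    · ring
    · linarith
    · linarith
    · rw [inner_eq, inner_eq, act_zero, act_one, hr2]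
      simp only [PiLp.sub_apply, J, Matrix.cons_val_zero, Matrix.cons_val_one, Matrix.of_apply,
        Matrix.cons_val']
      field_simp
      ring
    · rw [inner_eq, inner_eq, act_zero, act_one, hr2]
      simp only [PiLp.sub_apply, J, Matrix.cons_val_zero, Matrix.cons_val_one, Matrix.of_apply,
        Matrix.cons_val']
      field_simp
      ring

/-! ### The alignments chosen by Align -/

section NormalForm

variable {n : ℕ} {p : Fin n → Plane} {ℓ : Fin n → AffineSubspace ℝ Plane} {v : Fin n → Plane}
  {b : Fin n → ℝ}

/-- The datum of the `i`-th pair, given by the normal form of the line. -/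
def normalDatum (p v : Fin n → Plane) (b : Fin n → ℝ) (i : Fin n) : Datum :=
  ⟨p i 0, p i 1, v i 0, v i 1, b i⟩

theorem IsNormalForm.sq_add_sq (h : IsNormalForm ℓ v b) (i : Fin n) :
    v i 0 ^ 2 + v i 1 ^ 2 = 1 :=
  (norm_eq_one_iff _).1 (h i).1

theorem IsNormalForm.describes (h : IsNormalForm ℓ v b) (i : Fin n) :
    (normalDatum p v b i).Describes (p i) (ℓ i) := by
  refine ⟨?_, rfl, rfl, ?_⟩
  · have := h.sq_add_sq i
    simp only [normalDatum]
    linarith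
  · rw [(h i).2.2]
    simp only [inner_eq, normalDatum]

/-- Lagrange's identity: for unit vectors, the squares of the inner product and of the determinant
add up to 1. -/
theorem IsNormalForm.abs_inner_eq_one_iff (h : IsNormalForm ℓ v b) (j k : Fin n) :
    |inner ℝ (v j) (v k)| = 1 ↔ v j 0 * v k 1 - v k 0 * v j 1 = 0 := by
  have hj := h.sq_add_sq j
  have hk := h.sq_add_sq k
  have key : inner ℝ (v j) (v k) ^ 2 + (v j 0 * v k 1 - v k 0 * v j 1) ^ 2 = 1 := by
    rw [inner_eq]
    linear_combination (v k 0 ^ 2 + v k 1 ^ 2) * hj + hk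
  rw [← pow_eq_one_iff_of_nonneg (abs_nonneg _) two_ne_zero, sq_abs, ← pow_eq_zero_iff (two_ne_zero)]
  constructor <;> intro h <;> linarith

/-- Unit vectors x and alignments with both incidences correspond to each other by `exists_config`
and `exists_alignment`, and the objective is the distance of the third point from its line. The data
`D` may come from any equations of the lines, since rescaling changes neither zeros nor minimizers.
-/
theorem IsNormalForm.crossing_eq (h : IsNormalForm ℓ v b) {j k : Fin n}
    (hjk : |inner ℝ (v j) (v k)| ≠ 1) {D : Fin n → Datum}
    (hD : ∀ i, (D i).Describes (p i) (ℓ i)) (l : Fin n) :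
    crossing p ℓ v b j k l = Datum.crossSet (D j) (D k) (D l) := by
  have hdet : v j 0 * v k 1 - v k 0 * v j 1 ≠ 0 := fun h0 => hjk ((h.abs_inner_eq_one_iff j k).2 h0)
  have hvj := h.sq_add_sq j
  have hmem : ∀ i (q : Plane), q ∈ ℓ i ↔ v i 0 * q 0 + v i 1 * q 1 = b i := by
    intro i q
    rw [← SetLike.mem_coe, (h i).2.2, Set.mem_ofPred_eq, inner_eq]
  have hdist : ∀ a : Alignment, lineDist (a.app (p l)) (ℓ l) =
      |v l 0 * a.app (p l) 0 + v l 1 * a.app (p l) 1 - b l| := by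
    intro a
    have e := h.sq_add_sq l
    rw [lineDist_eq (α := v l 0) (β := v l 1) (γ := b l) (by linarith)
      (by rw [(h l).2.2]; simp only [inner_eq]), e, Real.sqrt_one, div_one]
  ext a
  simp only [Datum.crossSet, Set.mem_ofPred_eq, ← (hD _).mem_iff, ← (hD _).lineDist_le_iff, crossing]
  constructor
  · rintro ⟨s, x, hsj, hsk, hx, hmin, haj, hak, hal⟩
    rw [hmem] at hsj hsk
    obtain ⟨m, m', hP0, hP1, hQ0, hQ1, -⟩ := zConfigs_coords (z := p l)
      (p := p j) (q := p k) hvj hdet x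
    refine ⟨?_, ?_, ?_⟩
    · rw [hmem, haj, PiLp.add_apply, PiLp.add_apply, hP0, hP1]
      linear_combination hsj
    · rw [hmem, hak, PiLp.add_apply, PiLp.add_apply, hQ0, hQ1]
      linear_combination hsk
    · intro a' haj' hak'
      rw [hmem] at haj' hak'
      obtain ⟨y, hy, -, -, hyl⟩ := exists_config (z := p l) (s := s) hvj hdet
        (a := a') (p := p j) (q := p k) (by linarith) (by linarith)
      rw [hdist, hdist]
      refine (le_of_eq ?_).trans ((hmin y hy).trans (le_of_eq ?_))
      · rw [hal, inner_eq, inner_eq, PiLp.add_apply, PiLp.add_apply]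
        congr 1
        ring
      · rw [hyl, inner_eq, inner_eq, PiLp.add_apply, PiLp.add_apply]
        congr 1
        ring
  · rintro ⟨haj, hak, hmin⟩
    rw [hmem] at haj hak
    -- The common point of the two lines, by Cramer's rule.
    obtain ⟨s, hs⟩ : ∃ s : Plane, (v j 0 * s 0 + v j 1 * s 1 = b j) ∧
        v k 0 * s 0 + v k 1 * s 1 = b k := by
      refine ⟨!₂[(b j * v k 1 - b k * v j 1) / (v j 0 * v k 1 - v k 0 * v j 1),
        (v j 0 * b k - v k 0 * b j) / (v j 0 * v k 1 - v k 0 * v j 1)], ?_, ?_⟩ <;>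
      · simp only [Matrix.cons_val_zero, Matrix.cons_val_one]
        rw [mul_div_assoc', mul_div_assoc', ← add_div, div_eq_iff hdet]
        ring
    obtain ⟨x, hx, hxj, hxk, hxl⟩ := exists_config (z := p l) (s := s) hvj hdet
      (a := a) (p := p j) (q := p k) (by linarith [hs.1]) (by linarith [hs.2])
    refine ⟨s, x, (hmem _ _).2 hs.1, (hmem _ _).2 hs.2, hx, ?_, hxj, hxk, hxl⟩
    intro y hy
    obtain ⟨a', haj', hak', hal'⟩ := exists_alignment hvj hdet s (p j) (p k) (p l) hy
    obtain ⟨m, m', hP0, hP1, hQ0, hQ1, -⟩ := zConfigs_coords (z := p l)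
      (p := p j) (q := p k) hvj hdet y
    have key := hmin a'
      (by rw [hmem, haj', PiLp.add_apply, PiLp.add_apply, hP0, hP1]; linear_combination hs.1)
      (by rw [hmem, hak', PiLp.add_apply, PiLp.add_apply, hQ0, hQ1]; linear_combination hs.2)
    rw [hdist, hdist] at key
    refine (le_of_eq ?_).trans (key.trans (le_of_eq ?_))
    · rw [hxl, inner_eq, inner_eq, PiLp.add_apply, PiLp.add_apply]
      congr 1
      ring
    · rw [hal', inner_eq, inner_eq, PiLp.add_apply, PiLp.add_apply]
      congr 1
      ring

end NormalForm

/-! ### Minimizing the absolute value of an affine function on the unit circle -/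

/-- The squared distance. -/
def sqd (x y : ℝ × ℝ) : ℝ := (x.1 - y.1) ^ 2 + (x.2 - y.2) ^ 2

/-- The unit circle. -/
def circle : Set (ℝ × ℝ) := {x | x.1 ^ 2 + x.2 ^ 2 = 1}

theorem sqd_nonneg (x y : ℝ × ℝ) : 0 ≤ sqd x y := by unfold sqd; positivity

theorem sqd_eq_zero {x y : ℝ × ℝ} : sqd x y = 0 ↔ x = y := by
  constructor
  · intro h
    unfold sqd at h
    have h1 : (x.1 - y.1) ^ 2 = 0 := by nlinarith [sq_nonneg (x.1 - y.1), sq_nonneg (x.2 - y.2)]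
    have h2 : (x.2 - y.2) ^ 2 = 0 := by nlinarith [sq_nonneg (x.1 - y.1), sq_nonneg (x.2 - y.2)]
    exact Prod.ext (sub_eq_zero.1 (pow_eq_zero_iff two_ne_zero |>.1 h1))
      (sub_eq_zero.1 (pow_eq_zero_iff two_ne_zero |>.1 h2))
  · rintro rfl
    simp [sqd]

/-- By the parallelogram law, |y - z|² ≤ 2|x - y|² + 2|x - z|². -/
theorem sqd_le_four_mul {x y z : ℝ × ℝ} (h : sqd x y ≤ sqd x z) : sqd y z ≤ 4 * sqd x z := by
  unfold sqd at *
  nlinarith [sq_nonneg (x.1 - y.1 + (x.1 - z.1)), sq_nonneg (x.2 - y.2 + (x.2 - z.2))]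

/-- The points of the unit circle where `|A x + B y - G|` is minimal. -/
def circMin (A B G : ℝ) : Set (ℝ × ℝ) :=
  {x | x ∈ circle ∧ ∀ y ∈ circle, |A * x.1 + B * x.2 - G| ≤ |A * y.1 + B * y.2 - G|}

open Classical in
/-- Points of the unit circle where `|A x + B y - G|` is minimal, in closed form; the sign `ε`
selects one of the two. -/
def circSol (ε A B G : ℝ) : ℝ × ℝ :=
  if A ^ 2 + B ^ 2 = 0 then (1, 0)
  else if A ^ 2 + B ^ 2 < G ^ 2 then
    if 0 < G then (A / √(A ^ 2 + B ^ 2), B / √(A ^ 2 + B ^ 2))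
    else (-(A / √(A ^ 2 + B ^ 2)), -(B / √(A ^ 2 + B ^ 2)))
  else ((A * G - ε * (B * √(A ^ 2 + B ^ 2 - G ^ 2))) / (A ^ 2 + B ^ 2),
    (B * G + ε * (A * √(A ^ 2 + B ^ 2 - G ^ 2))) / (A ^ 2 + B ^ 2))

theorem circSol_mem_circle {ε : ℝ} (hε : ε ^ 2 = 1) (A B G : ℝ) : circSol ε A B G ∈ circle := by
  unfold circSol circle
  split_ifs with h0 h1 h2
  · simp
  · have : √(A ^ 2 + B ^ 2) ^ 2 = A ^ 2 + B ^ 2 := Real.sq_sqrt (by positivity)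
    simp only [Set.mem_ofPred_eq]
    rw [div_pow, div_pow, this, ← add_div, div_self h0]
  · have : √(A ^ 2 + B ^ 2) ^ 2 = A ^ 2 + B ^ 2 := Real.sq_sqrt (by positivity)
    simp only [Set.mem_ofPred_eq]
    rw [neg_sq, neg_sq, div_pow, div_pow, this, ← add_div, div_self h0]
  · have : √(A ^ 2 + B ^ 2 - G ^ 2) ^ 2 = A ^ 2 + B ^ 2 - G ^ 2 := Real.sq_sqrt (by linarith)
    simp only [Set.mem_ofPred_eq]
    rw [div_pow, div_pow, ← add_div, div_eq_one_iff_eq (pow_ne_zero 2 h0)]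
    linear_combination (ε ^ 2 * (A ^ 2 + B ^ 2)) * this + ((A ^ 2 + B ^ 2) *
      (A ^ 2 + B ^ 2 - G ^ 2)) * hε

/-- The line A X + B Y = G misses the circle, so the affine function keeps one sign there. The
minimizer z is the unit normal pointing towards the line, and the inner product of unit vectors is 1
- |x - z|²/2. The sign `ε` plays no role in this case. -/
theorem abs_eq_of_far {A B G ε : ℝ} (h0 : A ^ 2 + B ^ 2 ≠ 0) (h1 : A ^ 2 + B ^ 2 < G ^ 2)
    {x : ℝ × ℝ} (hx : x ∈ circle) :
    |A * x.1 + B * x.2 - G| = |G| - √(A ^ 2 + B ^ 2) +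
      √(A ^ 2 + B ^ 2) / 2 * sqd x (circSol ε A B G) := by
  have hpos : 0 < A ^ 2 + B ^ 2 := lt_of_le_of_ne (by positivity) (Ne.symm h0)
  have hρ : 0 < √(A ^ 2 + B ^ 2) := Real.sqrt_pos.2 hpos
  have hρ2 : √(A ^ 2 + B ^ 2) ^ 2 = A ^ 2 + B ^ 2 := Real.sq_sqrt hpos.le
  have hu : (A * x.1 + B * x.2) ^ 2 ≤ A ^ 2 + B ^ 2 := by
    have hx' : x.1 ^ 2 + x.2 ^ 2 = 1 := hx
    have : (A * x.1 + B * x.2) ^ 2 + (A * x.2 - B * x.1) ^ 2 = A ^ 2 + B ^ 2 := by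
      linear_combination (A ^ 2 + B ^ 2) * hx'
    nlinarith [sq_nonneg (A * x.2 - B * x.1)]
  have hlt : |A * x.1 + B * x.2| < |G| := sq_lt_sq.1 (lt_of_le_of_lt hu h1)
  have hx' : x.1 ^ 2 + x.2 ^ 2 = 1 := hx
  have hz := circSol_mem_circle (ε := 1) (by norm_num) A B G
  unfold circSol circle at hz
  unfold circSol sqd
  rw [if_neg h0, if_pos h1] at hz ⊢
  split_ifs at hz ⊢ with h2
  · rw [abs_of_pos h2] at hlt ⊢
    rw [abs_of_neg (by linarith [(abs_lt.1 hlt).2])]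
    simp only [Set.mem_ofPred_eq] at hz
    simp only
    set ρ := √(A ^ 2 + B ^ 2)
    have e1 : ρ * (A / ρ) = A := mul_div_cancel₀ A hρ.ne'
    have e2 : ρ * (B / ρ) = B := mul_div_cancel₀ B hρ.ne'
    linear_combination (-ρ / 2) * hz + (-ρ / 2) * hx' + x.1 * e1 + x.2 * e2
  · rw [abs_of_nonpos (not_lt.1 h2)] at hlt ⊢
    rw [abs_of_pos (by linarith [(abs_lt.1 hlt).1])]
    simp only [Set.mem_ofPred_eq] at hz
    simp only
    set ρ := √(A ^ 2 + B ^ 2)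
    have e1 : ρ * (A / ρ) = A := mul_div_cancel₀ A hρ.ne'
    have e2 : ρ * (B / ρ) = B := mul_div_cancel₀ B hρ.ne'
    linear_combination (-ρ / 2) * hz + (-ρ / 2) * hx' - x.1 * e1 - x.2 * e2

/-- The line meets the circle at the two closed-form points, which coincide if it is tangent. In the
triangle that they form with x, the altitude from x times the diameter 2 of the circumcircle equals
the product of the adjacent sides. -/
theorem sq_eq_of_near {A B G : ℝ} (h0 : A ^ 2 + B ^ 2 ≠ 0) (h1 : ¬ A ^ 2 + B ^ 2 < G ^ 2)
    {x : ℝ × ℝ} (hx : x ∈ circle) :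
    (A * x.1 + B * x.2 - G) ^ 2 = (A ^ 2 + B ^ 2) / 4 *
      (sqd x (circSol 1 A B G) * sqd x (circSol (-1) A B G)) := by
  have hx' : x.1 ^ 2 + x.2 ^ 2 = 1 := hx
  have expand : ∀ z ∈ circle, sqd x z = 2 - 2 * (x.1 * z.1 + x.2 * z.2) := by
    intro z hz
    have hz' : z.1 ^ 2 + z.2 ^ 2 = 1 := hz
    unfold sqd
    linear_combination hx' + hz'
  rw [expand _ (circSol_mem_circle (by norm_num) A B G),
    expand _ (circSol_mem_circle (by norm_num) A B G)]
  have hw : √(A ^ 2 + B ^ 2 - G ^ 2) ^ 2 = A ^ 2 + B ^ 2 - G ^ 2 := Real.sq_sqrt (by linarith)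
  unfold circSol
  simp only [if_neg h0, if_neg h1]
  set w := √(A ^ 2 + B ^ 2 - G ^ 2)
  set N := A ^ 2 + B ^ 2 with hN
  have hut : (B * x.1 - A * x.2) ^ 2 = N - (A * x.1 + B * x.2) ^ 2 := by
    rw [hN]
    linear_combination (A ^ 2 + B ^ 2) * hx'
  field_simp
  linear_combination (4 * (B * x.1 - A * x.2) ^ 2) * hw + 4 * (N - G ^ 2) * hut

theorem circSol_mem {ε : ℝ} (hε : ε = 1 ∨ ε = -1) (A B G : ℝ) :
    circSol ε A B G ∈ circMin A B G := by
  have hε2 : ε ^ 2 = 1 := by rcases hε with rfl | rfl <;> norm_num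
  have hmem := circSol_mem_circle hε2 A B G
  refine ⟨hmem, fun y hy => ?_⟩
  by_cases h0 : A ^ 2 + B ^ 2 = 0
  · have hA : A = 0 := by nlinarith [sq_nonneg A, sq_nonneg B]
    have hB : B = 0 := by nlinarith [sq_nonneg A, sq_nonneg B]
    simp [hA, hB]
  by_cases h1 : A ^ 2 + B ^ 2 < G ^ 2
  · rw [abs_eq_of_far (ε := ε) h0 h1 hmem, abs_eq_of_far (ε := ε) h0 h1 hy, sqd_eq_zero.2 rfl]
    have := mul_nonneg (Real.sqrt_nonneg (A ^ 2 + B ^ 2)) (sqd_nonneg y (circSol ε A B G))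
    linarith
  · have : (A * (circSol ε A B G).1 + B * (circSol ε A B G).2 - G) ^ 2 = 0 := by
      rw [sq_eq_of_near h0 h1 hmem]
      rcases hε with rfl | rfl
      · rw [sqd_eq_zero.2 rfl]; ring
      · rw [sqd_eq_zero (y := circSol (-1) A B G).2 rfl]; ring
    rw [pow_eq_zero_iff two_ne_zero |>.1 this, abs_zero]
    exact abs_nonneg _

/-- In the far case the quadratic term excludes any other minimizer; in the near case the minimum is
0, and the product of distances vanishes only at its two zeros. -/
theorem circMin_eq {A B : ℝ} (h0 : A ^ 2 + B ^ 2 ≠ 0) (G : ℝ) :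
    circMin A B G = {circSol 1 A B G, circSol (-1) A B G} := by
  have hpos : 0 < A ^ 2 + B ^ 2 := lt_of_le_of_ne (by positivity) (Ne.symm h0)
  apply Set.Subset.antisymm
  · rintro x ⟨hx, hmin⟩
    have h := hmin _ (circSol_mem (Or.inl rfl) A B G).1
    by_cases h1 : A ^ 2 + B ^ 2 < G ^ 2
    · rw [abs_eq_of_far (ε := 1) h0 h1 hx,
        abs_eq_of_far (ε := 1) h0 h1 (circSol_mem (Or.inl rfl) A B G).1, sqd_eq_zero.2 rfl] at h
      left
      have hρ : 0 < √(A ^ 2 + B ^ 2) := Real.sqrt_pos.2 hpos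
      refine sqd_eq_zero.1 (le_antisymm ?_ (sqd_nonneg _ _))
      by_contra hc
      have := mul_pos hρ (not_le.1 hc)
      linarith
    · have hz : A * (circSol 1 A B G).1 + B * (circSol 1 A B G).2 - G = 0 := by
        rw [← pow_eq_zero_iff two_ne_zero,
          sq_eq_of_near h0 h1 (circSol_mem (Or.inl rfl) A B G).1, sqd_eq_zero.2 rfl]
        ring
      rw [hz, abs_zero] at h
      have h' := sq_eq_of_near h0 h1 hx
      rw [abs_eq_zero.1 (le_antisymm h (abs_nonneg _)), zero_pow two_ne_zero, eq_comm,
        mul_eq_zero, mul_eq_zero, sqd_eq_zero, sqd_eq_zero] at h'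
      exact h'.resolve_left (by positivity)
  · rintro x (rfl | rfl)
    · exact circSol_mem (Or.inl rfl) A B G
    · exact circSol_mem (Or.inr rfl) A B G

/-- A point of the circle at least as close to `x` as every minimizer has a value that exceeds the
value at `x` by a factor of at most `4`. -/
theorem abs_le_four_mul {A B G : ℝ} {x y : ℝ × ℝ} (hx : x ∈ circle) (hy : y ∈ circle)
    (h : A ^ 2 + B ^ 2 ≠ 0 → ∀ z ∈ circMin A B G, sqd x y ≤ sqd x z) :
    |A * y.1 + B * y.2 - G| ≤ 4 * |A * x.1 + B * x.2 - G| := by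
  by_cases h0 : A ^ 2 + B ^ 2 = 0
  · have hA : A = 0 := by nlinarith [sq_nonneg A, sq_nonneg B]
    have hB : B = 0 := by nlinarith [sq_nonneg A, sq_nonneg B]
    simp only [hA, hB, zero_mul, zero_add, zero_sub, abs_neg]
    linarith [abs_nonneg G]
  have hpos : 0 < A ^ 2 + B ^ 2 := lt_of_le_of_ne (by positivity) (Ne.symm h0)
  have key₁ := sqd_le_four_mul (h h0 _ (circSol_mem (Or.inl rfl) A B G))
  have key₂ := sqd_le_four_mul (h h0 _ (circSol_mem (Or.inr rfl) A B G))
  by_cases h1 : A ^ 2 + B ^ 2 < G ^ 2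
  · rw [abs_eq_of_far (ε := 1) h0 h1 hx, abs_eq_of_far (ε := 1) h0 h1 hy]
    -- The constant part |G| - √(A² + B²) is nonnegative, so only the quadratic part can use up the
    -- factor 4.
    have hG : √(A ^ 2 + B ^ 2) ≤ |G| := by
      rw [← Real.sqrt_sq_eq_abs]
      exact Real.sqrt_le_sqrt h1.le
    have := mul_le_mul_of_nonneg_left key₁ (Real.sqrt_nonneg (A ^ 2 + B ^ 2))
    linarith
  -- Compare squares: each of the two squared distances grows by at most 4, and 4 · 4 = 4².
  · rw [← abs_of_pos (zero_lt_four (α := ℝ)), ← abs_mul, ← sq_le_sq, mul_pow,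
      sq_eq_of_near h0 h1 hx, sq_eq_of_near h0 h1 hy]
    have := mul_le_mul_of_nonneg_left
      (mul_le_mul key₁ key₂ (sqd_nonneg _ _) (by linarith [sqd_nonneg x (circSol 1 A B G)]))
      hpos.le
    linarith

theorem infinite_circle : circle.Infinite := by
  have hinj : Function.Injective
      (fun t : ℝ => (Real.cos (Real.arctan t), Real.sin (Real.arctan t))) := by
    intro t t' h
    have h1 := congrArg Prod.fst h
    have h2 := congrArg Prod.snd h
    simp only at h1 h2
    rw [← Real.tan_arctan t, ← Real.tan_arctan t', Real.tan_eq_sin_div_cos,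
      Real.tan_eq_sin_div_cos, h1, h2]
  refine (Set.infinite_range_of_injective hinj).mono ?_
  rintro _ ⟨t, rfl⟩
  exact Real.cos_sq_add_sin_sq _

/-! ### One-parameter families of alignments -/

/-- Coefficients `U`, `W` of a translation `e₁ U + e₂ W` that depends on the rotation through the
offsets `e₁`, `e₂` of two points from their lines. -/
structure Frame where
  U₀ : ℝ
  U₁ : ℝ
  W₀ : ℝ
  W₁ : ℝ

namespace Datum

/-- The offset of the rotated point from its line. -/
def off (d : Datum) (x : ℝ × ℝ) : ℝ :=
  (d.α * d.x + d.β * d.y) * x.1 + (d.β * d.x - d.α * d.y) * x.2 - d.γ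

/-- The rotation of an alignment as a point of the unit circle. -/
def _root_.PointsToLines.Alignment.rot (a : Alignment) : ℝ × ℝ := (a.cos, a.sin)

theorem _root_.PointsToLines.Alignment.rot_mem (a : Alignment) : a.rot ∈ circle :=
  a.cos_sq_add_sin_sq

theorem res_eq (d : Datum) (a : Alignment) :
    d.res a = d.off a.rot - (d.α * a.2 0 + d.β * a.2 1) := by
  unfold res off Alignment.rot
  ring

end Datum

namespace Frame

open Datum

variable (F : Frame) (d₁ d₂ d₃ : Datum)

/-- The coefficient of the cosine in the offset of the third point. -/
def A : ℝ := (d₃.α * d₃.x + d₃.β * d₃.y) -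
  (d₃.α * F.U₀ + d₃.β * F.U₁) * (d₁.α * d₁.x + d₁.β * d₁.y) -
  (d₃.α * F.W₀ + d₃.β * F.W₁) * (d₂.α * d₂.x + d₂.β * d₂.y)

/-- The coefficient of the sine in the offset of the third point. -/
def B : ℝ := (d₃.β * d₃.x - d₃.α * d₃.y) -
  (d₃.α * F.U₀ + d₃.β * F.U₁) * (d₁.β * d₁.x - d₁.α * d₁.y) -
  (d₃.α * F.W₀ + d₃.β * F.W₁) * (d₂.β * d₂.x - d₂.α * d₂.y)

/-- The constant term in the offset of the third point. -/
def G : ℝ := d₃.γ - (d₃.α * F.U₀ + d₃.β * F.U₁) * d₁.γ - (d₃.α * F.W₀ + d₃.β * F.W₁) * d₂.γ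

/-- The translation of the family, first coordinate. -/
def t₀ (x : ℝ × ℝ) : ℝ := d₁.off x * F.U₀ + d₂.off x * F.W₀

/-- The translation of the family, second coordinate. -/
def t₁ (x : ℝ × ℝ) : ℝ := d₁.off x * F.U₁ + d₂.off x * F.W₁

/-- The member of the family with a given rotation. -/
def al {x : ℝ × ℝ} (hx : x ∈ circle) : Alignment :=
  Alignment.mk x.1 x.2 (F.t₀ d₁ d₂ x) (F.t₁ d₁ d₂ x) hx

variable {F d₁ d₂ d₃}

theorem al_rot {x : ℝ × ℝ} (hx : x ∈ circle) : (F.al d₁ d₂ hx).rot = x := rfl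

theorem eq_al {a : Alignment} (h0 : a.2 0 = F.t₀ d₁ d₂ a.rot) (h1 : a.2 1 = F.t₁ d₁ d₂ a.rot) :
    a = F.al d₁ d₂ a.rot_mem :=
  Alignment.ext_coords rfl rfl h0 h1

/-- The translation is linear in the two offsets, which are affine in the rotation; hence so is the
defect of any further pair. -/
theorem res_of_eq {a : Alignment} (h0 : a.2 0 = F.t₀ d₁ d₂ a.rot)
    (h1 : a.2 1 = F.t₁ d₁ d₂ a.rot) :
    d₃.res a = F.A d₁ d₂ d₃ * a.rot.1 + F.B d₁ d₂ d₃ * a.rot.2 - F.G d₁ d₂ d₃ := by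
  rw [res_eq, h0, h1]
  unfold A B G t₀ t₁ off
  ring

/-! ### The crossing family and the sliding family. -/

/-- The family of the alignments that take two points to their lines, if these are not parallel. -/
def cross (d₁ d₂ : Datum) : Frame :=
  ⟨d₂.β / d₁.det d₂, -d₂.α / d₁.det d₂, -d₁.β / d₁.det d₂, d₁.α / d₁.det d₂⟩

/-- A family of alignments that take a point to its line. -/
def slide (d : Datum) : Frame :=
  ⟨d.α / (d.α ^ 2 + d.β ^ 2), d.β / (d.α ^ 2 + d.β ^ 2), 0, 0⟩

/-- For a fixed rotation the two incidences are a linear system for the translation; this is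
Cramer's rule. -/
theorem cross_iff (h : d₁.det d₂ ≠ 0) (a : Alignment) :
    (d₁.res a = 0 ∧ d₂.res a = 0) ↔
      (a.2 0 = (cross d₁ d₂).t₀ d₁ d₂ a.rot ∧ a.2 1 = (cross d₁ d₂).t₁ d₁ d₂ a.rot) := by
  have h' : d₁.α * d₂.β - d₂.α * d₁.β ≠ 0 := h
  rw [res_eq, res_eq]
  unfold t₀ t₁ cross
  generalize d₁.off a.rot = e₁
  generalize d₂.off a.rot = e₂
  simp only [mul_div_assoc', ← add_div, eq_div_iff h]
  unfold det
  constructor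
  · rintro ⟨h1, h2⟩
    constructor
    · linear_combination (-d₂.β) * h1 + d₁.β * h2
    · linear_combination (-d₁.α) * h2 + d₂.α * h1
  · rintro ⟨h1, h2⟩
    constructor
    · apply (mul_eq_zero.1 _).resolve_left h'
      linear_combination (-d₁.α) * h1 - d₁.β * h2
    · apply (mul_eq_zero.1 _).resolve_left h'
      linear_combination (-d₂.α) * h1 - d₂.β * h2

theorem mem_crossSet (h : d₁.det d₂ ≠ 0) (a : Alignment) :
    a ∈ crossSet d₁ d₂ d₃ ↔
      (a.2 0 = (cross d₁ d₂).t₀ d₁ d₂ a.rot ∧ a.2 1 = (cross d₁ d₂).t₁ d₁ d₂ a.rot) ∧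
      a.rot ∈ circMin ((cross d₁ d₂).A d₁ d₂ d₃) ((cross d₁ d₂).B d₁ d₂ d₃)
        ((cross d₁ d₂).G d₁ d₂ d₃) := by
  simp only [crossSet, Set.mem_ofPred_eq, ← and_imp]
  rw [← and_assoc, cross_iff h]
  refine and_congr_right fun ha => ?_
  rw [res_of_eq ha.1 ha.2]
  constructor
  · refine fun hmin => ⟨a.rot_mem, fun y hy => ?_⟩
    have := hmin ((cross d₁ d₂).al d₁ d₂ hy) ((cross_iff h _).2 ⟨rfl, rfl⟩)
    rwa [res_of_eq (F := cross d₁ d₂) (d₁ := d₁) (d₂ := d₂) rfl rfl, al_rot] at this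
  · rintro ⟨-, hmin⟩ a' ha'
    rw [cross_iff h] at ha'
    rw [res_of_eq ha'.1 ha'.2]
    exact hmin _ a'.rot_mem

theorem res_slide (h : 0 < d₁.α ^ 2 + d₁.β ^ 2) {a : Alignment}
    (h0 : a.2 0 = (slide d₁).t₀ d₁ d₂ a.rot) (h1 : a.2 1 = (slide d₁).t₁ d₁ d₂ a.rot) :
    d₁.res a = 0 := by
  rw [res_eq, h0, h1]
  unfold t₀ t₁ slide
  field_simp
  ring

/-- The remaining freedom is to slide along the first line, and this leaves the defect of a parallel
line unchanged. So any translation with the incidence gives the same value as the one in `slide`. -/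
theorem res_of_parallel (h : 0 < d₁.α ^ 2 + d₁.β ^ 2) (hdet : d₁.det d₂ = 0) {a : Alignment}
    (ha : d₁.res a = 0) :
    d₂.res a = (slide d₁).A d₁ d₂ d₂ * a.rot.1 + (slide d₁).B d₁ d₂ d₂ * a.rot.2 -
      (slide d₁).G d₁ d₂ d₂ := by
  have hdet' : d₁.α * d₂.β - d₂.α * d₁.β = 0 := hdet
  rw [res_eq] at ha ⊢
  unfold A B G slide
  unfold off at *
  field_simp
  linear_combination (d₂.α * d₁.α + d₂.β * d₁.β) * ha + (a.2 0 * d₁.β - a.2 1 * d₁.α) * hdet'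

theorem mem_slideSet (h : 0 < d₁.α ^ 2 + d₁.β ^ 2) (hdet : d₁.det d₂ = 0) (a : Alignment) :
    a ∈ slideSet d₁ d₂ ↔ d₁.res a = 0 ∧
      a.rot ∈ circMin ((slide d₁).A d₁ d₂ d₂) ((slide d₁).B d₁ d₂ d₂) ((slide d₁).G d₁ d₂ d₂) := by
  simp only [slideSet, Set.mem_ofPred_eq]
  refine and_congr_right fun ha => ?_
  rw [res_of_parallel h hdet ha]
  constructor
  · refine fun hmin => ⟨a.rot_mem, fun y hy => ?_⟩
    have ha' : d₁.res ((slide d₁).al d₁ d₂ hy) = 0 := res_slide (d₂ := d₂) h rfl rfl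
    have := hmin _ ha'
    rwa [res_of_parallel h hdet ha', al_rot] at this
  · rintro ⟨-, hmin⟩ a' ha'
    rw [res_of_parallel h hdet ha']
    exact hmin _ a'.rot_mem

variable (F d₁ d₂ d₃)

theorem circSol_mem_circle' (ε : ℤˣ) (A B G : ℝ) : circSol ((ε : ℤ) : ℝ) A B G ∈ circle := by
  apply circSol_mem_circle
  rcases Int.units_eq_one_or ε with rfl | rfl <;> norm_num

/-- The members of the family that take the third point as close to its line as possible, in
closed form. -/
def best (ε : ℤˣ) : Alignment :=
  F.al d₁ d₂ (circSol_mem_circle' ε (F.A d₁ d₂ d₃) (F.B d₁ d₂ d₃) (F.G d₁ d₂ d₃))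

variable {F d₁ d₂ d₃}

theorem best_rot (ε : ℤˣ) : (F.best d₁ d₂ d₃ ε).rot =
    circSol ((ε : ℤ) : ℝ) (F.A d₁ d₂ d₃) (F.B d₁ d₂ d₃) (F.G d₁ d₂ d₃) := rfl

theorem best_rot_mem (ε : ℤˣ) : (F.best d₁ d₂ d₃ ε).rot ∈
    circMin (F.A d₁ d₂ d₃) (F.B d₁ d₂ d₃) (F.G d₁ d₂ d₃) := by
  rw [best_rot]
  apply circSol_mem
  rcases Int.units_eq_one_or ε with rfl | rfl <;> simp

theorem al_congr {x y : ℝ × ℝ} (hx : x ∈ circle) (hy : y ∈ circle) (h : x = y) :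
    F.al d₁ d₂ hx = F.al d₁ d₂ hy := by
  subst h
  rfl

theorem exists_best {x : ℝ × ℝ} (hx : x ∈ circle)
    (hN : F.A d₁ d₂ d₃ ^ 2 + F.B d₁ d₂ d₃ ^ 2 ≠ 0)
    (hmin : x ∈ circMin (F.A d₁ d₂ d₃) (F.B d₁ d₂ d₃) (F.G d₁ d₂ d₃)) :
    F.al d₁ d₂ hx = F.best d₁ d₂ d₃ 1 ∨ F.al d₁ d₂ hx = F.best d₁ d₂ d₃ (-1) := by
  rw [circMin_eq hN] at hmin
  rcases hmin with h | h
  · exact Or.inl (al_congr _ _ (by rw [h]; simp))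
  · exact Or.inr (al_congr _ _ (by rw [h]; simp))

theorem best_eq_of_zero (hN : F.A d₁ d₂ d₃ ^ 2 + F.B d₁ d₂ d₃ ^ 2 = 0) :
    F.best d₁ d₂ d₃ (-1) = F.best d₁ d₂ d₃ 1 := by
  apply al_congr
  unfold circSol
  rw [if_pos hN, if_pos hN]

theorem circMin_of_zero {A B : ℝ} (hN : A ^ 2 + B ^ 2 = 0) (G : ℝ) : circMin A B G = circle := by
  have hA : A = 0 := by nlinarith [sq_nonneg A, sq_nonneg B]
  have hB : B = 0 := by nlinarith [sq_nonneg A, sq_nonneg B]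
  ext x
  simp [circMin, hA, hB]

/-! ### The closed forms as legitimate selections. -/

theorem best_mem_crossSet (h : d₁.det d₂ ≠ 0) (ε : ℤˣ) :
    (cross d₁ d₂).best d₁ d₂ d₃ ε ∈ crossSet d₁ d₂ d₃ :=
  (mem_crossSet h _).2 ⟨⟨rfl, rfl⟩, best_rot_mem ε⟩

theorem crossSet_eq (h : d₁.det d₂ ≠ 0)
    (hN : (cross d₁ d₂).A d₁ d₂ d₃ ^ 2 + (cross d₁ d₂).B d₁ d₂ d₃ ^ 2 ≠ 0) :
    crossSet d₁ d₂ d₃ =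
      {(cross d₁ d₂).best d₁ d₂ d₃ 1, (cross d₁ d₂).best d₁ d₂ d₃ (-1)} := by
  apply Set.Subset.antisymm
  · intro a ha
    obtain ⟨⟨h0, h1⟩, hmin⟩ := (mem_crossSet h a).1 ha
    rw [eq_al h0 h1]
    exact exists_best a.rot_mem hN hmin
  · rintro a (rfl | rfl) <;> exact best_mem_crossSet h _

theorem crossSet_infinite (h : d₁.det d₂ ≠ 0)
    (hN : (cross d₁ d₂).A d₁ d₂ d₃ ^ 2 + (cross d₁ d₂).B d₁ d₂ d₃ ^ 2 = 0) :
    (crossSet d₁ d₂ d₃).Infinite := by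
  refine Set.Infinite.of_image Alignment.rot (infinite_circle.mono fun x hx => ?_)
  refine ⟨(cross d₁ d₂).al d₁ d₂ hx, (mem_crossSet h _).2 ⟨⟨rfl, rfl⟩, ?_⟩, rfl⟩
  rw [circMin_of_zero hN]
  exact hx

/-- In the degenerate case A = B = 0 every rotation is optimal, and both closed forms collapse to
one alignment, as required of a selection from an infinite set. -/
theorem isSelection_best (h : d₁.det d₂ ≠ 0) :
    IsSelection (crossSet d₁ d₂ d₃)
      {(cross d₁ d₂).best d₁ d₂ d₃ 1, (cross d₁ d₂).best d₁ d₂ d₃ (-1)} := by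
  by_cases hN : (cross d₁ d₂).A d₁ d₂ d₃ ^ 2 + (cross d₁ d₂).B d₁ d₂ d₃ ^ 2 = 0
  · refine Or.inr ⟨crossSet_infinite h hN, _, best_mem_crossSet h 1, ?_⟩
    rw [best_eq_of_zero hN, Set.pair_eq_singleton]
  · rw [crossSet_eq h hN]
    exact Or.inl ⟨Set.toFinite _, rfl⟩

theorem best_mem_slideSet (h : 0 < d₁.α ^ 2 + d₁.β ^ 2) (hdet : d₁.det d₂ = 0) (ε : ℤˣ) :
    (slide d₁).best d₁ d₂ d₂ ε ∈ slideSet d₁ d₂ :=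
  (mem_slideSet h hdet _).2 ⟨res_slide (d₂ := d₂) h rfl rfl, best_rot_mem ε⟩

theorem fst_mem_of_slideSet (h : 0 < d₁.α ^ 2 + d₁.β ^ 2) (hdet : d₁.det d₂ = 0)
    (hN : (slide d₁).A d₁ d₂ d₂ ^ 2 + (slide d₁).B d₁ d₂ d₂ ^ 2 ≠ 0) {a : Alignment}
    (ha : a ∈ slideSet d₁ d₂) :
    a.1 = ((slide d₁).best d₁ d₂ d₂ 1).1 ∨ a.1 = ((slide d₁).best d₁ d₂ d₂ (-1)).1 := by
  have e : a.1 = ((slide d₁).al d₁ d₂ a.rot_mem).1 :=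
    (Alignment.fst_eq_iff _ _).2 ⟨rfl, rfl⟩
  rw [e]
  exact (exists_best a.rot_mem hN ((mem_slideSet h hdet a).1 ha).2).imp
    (congrArg Prod.fst) (congrArg Prod.fst)

theorem slideSet_finite (h : 0 < d₁.α ^ 2 + d₁.β ^ 2) (hdet : d₁.det d₂ = 0)
    (hN : (slide d₁).A d₁ d₂ d₂ ^ 2 + (slide d₁).B d₁ d₂ d₂ ^ 2 ≠ 0) :
    (Prod.fst '' slideSet d₁ d₂).Finite := by
  refine (Set.toFinite {((slide d₁).best d₁ d₂ d₂ 1).1,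
    ((slide d₁).best d₁ d₂ d₂ (-1)).1}).subset ?_
  rintro _ ⟨a, ha, rfl⟩
  exact fst_mem_of_slideSet h hdet hN ha

theorem slideSet_infinite (h : 0 < d₁.α ^ 2 + d₁.β ^ 2) (hdet : d₁.det d₂ = 0)
    (hN : (slide d₁).A d₁ d₂ d₂ ^ 2 + (slide d₁).B d₁ d₂ d₂ ^ 2 = 0) :
    (Prod.fst '' slideSet d₁ d₂).Infinite := by
  refine Set.Infinite.of_image (fun R => Alignment.rot (R, 0))
    (infinite_circle.mono fun x hx => ?_)
  refine ⟨_, ⟨(slide d₁).al d₁ d₂ hx, (mem_slideSet h hdet _).2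
    ⟨res_slide (d₂ := d₂) h rfl rfl, ?_⟩, rfl⟩, rfl⟩
  rw [circMin_of_zero hN]
  exact hx

theorem best_eq_of_fst_eq {ε ε' : ℤˣ} (h : (F.best d₁ d₂ d₃ ε).1 = (F.best d₁ d₂ d₃ ε').1) :
    F.best d₁ d₂ d₃ ε = F.best d₁ d₂ d₃ ε' := by
  obtain ⟨hc, hs⟩ := (Alignment.fst_eq_iff _ _).1 h
  exact al_congr _ _ (Prod.ext hc hs)

/-- Here the optimal set fixes only the rotation. The closed forms contain one translation per
rotation because within the family the rotation determines the translation (`best_eq_of_fst_eq`). -/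
theorem isSelectionPerRotation_best (h : 0 < d₁.α ^ 2 + d₁.β ^ 2) (hdet : d₁.det d₂ = 0) :
    IsSelectionPerRotation (slideSet d₁ d₂)
      {(slide d₁).best d₁ d₂ d₂ 1, (slide d₁).best d₁ d₂ d₂ (-1)} := by
  by_cases hN : (slide d₁).A d₁ d₂ d₂ ^ 2 + (slide d₁).B d₁ d₂ d₂ ^ 2 = 0
  · refine Or.inr ⟨slideSet_infinite h hdet hN, _, best_mem_slideSet h hdet 1, ?_⟩
    rw [best_eq_of_zero hN, Set.pair_eq_singleton]
  · refine Or.inl ⟨slideSet_finite h hdet hN, ?_, ?_⟩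
    · rintro a (rfl | rfl) <;> exact best_mem_slideSet h hdet _
    · rintro _ ⟨a, ha, rfl⟩
      obtain ⟨ε, hε⟩ : ∃ ε : ℤˣ, a.1 = ((slide d₁).best d₁ d₂ d₂ ε).1 :=
        (fst_mem_of_slideSet h hdet hN ha).elim (fun e => ⟨1, e⟩) (fun e => ⟨-1, e⟩)
      rw [hε]
      refine ⟨((slide d₁).best d₁ d₂ d₂ ε).2, ?_, ?_⟩
      · rcases Int.units_eq_one_or ε with rfl | rfl
        · exact Or.inl rfl
        · exact Or.inr rfl
      · intro t ht
        obtain ⟨ε', hε'⟩ : ∃ ε' : ℤˣ, (((slide d₁).best d₁ d₂ d₂ ε).1, t) =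
            (slide d₁).best d₁ d₂ d₂ ε' := ht.elim (fun e => ⟨1, e⟩) (fun e => ⟨-1, e⟩)
        have e := best_eq_of_fst_eq (F := slide d₁) (d₁ := d₁) (d₂ := d₂) (d₃ := d₂) (ε := ε)
          (ε' := ε') (Prod.ext_iff.1 hε').1
        rw [e, ← hε']

/-! ### The number of chosen alignments -/

theorem ncard_pair_le {X : Type*} (x y : X) : ({x, y} : Set X).ncard ≤ 2 :=
  (Set.ncard_insert_le _ _).trans (by rw [Set.ncard_singleton])

theorem ncard_of_isSelection (h : d₁.det d₂ ≠ 0) {S : Set Alignment}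
    (hS : IsSelection (crossSet d₁ d₂ d₃) S) : S.Finite ∧ S.ncard ≤ 2 := by
  rcases hS with ⟨hF, rfl⟩ | ⟨-, a, -, rfl⟩
  · have hN := fun hN => crossSet_infinite (d₃ := d₃) h hN hF
    exact ⟨hF, by rw [crossSet_eq h hN]; exact ncard_pair_le _ _⟩
  · exact ⟨Set.finite_singleton a, by rw [Set.ncard_singleton]; norm_num⟩

/-- Uniqueness of the translation makes the projection to rotations injective on `S`, and at most
two rotations occur when they are finitely many. -/
theorem ncard_of_isSelectionPerRotation (h : 0 < d₁.α ^ 2 + d₁.β ^ 2) (hdet : d₁.det d₂ = 0)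
    {S : Set Alignment} (hS : IsSelectionPerRotation (slideSet d₁ d₂) S) :
    S.Finite ∧ S.ncard ≤ 2 := by
  rcases hS with ⟨hF, hSF, huniq⟩ | ⟨-, a, -, rfl⟩
  · have hN := fun hN => slideSet_infinite h hdet hN hF
    have hinj : Set.InjOn Prod.fst S := by
      rintro ⟨R, t⟩ ha ⟨R', t'⟩ hb hab
      have hab : R = R' := hab
      subst hab
      rw [(huniq R ⟨_, hSF ha, rfl⟩).unique ha hb]
    have hsub : Prod.fst '' S ⊆ {((slide d₁).best d₁ d₂ d₂ 1).1,
        ((slide d₁).best d₁ d₂ d₂ (-1)).1} := by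
      rintro _ ⟨a, ha, rfl⟩
      exact fst_mem_of_slideSet h hdet hN (hSF ha)
    refine ⟨Set.Finite.of_finite_image ((Set.toFinite _).subset hsub) hinj, ?_⟩
    rw [← hinj.ncard_image]
    exact (Set.ncard_le_ncard hsub (Set.toFinite _)).trans (ncard_pair_le _ _)
  · exact ⟨Set.finite_singleton a, by rw [Set.ncard_singleton]; norm_num⟩

end Frame

/-! ### The approximation guarantee -/

theorem IsSelection.exists_mem {F S : Set Alignment} (h : IsSelection F S) (hF : F.Nonempty) :
    ∃ a ∈ S, a ∈ F := by
  rcases h with ⟨-, rfl⟩ | ⟨-, a, ha, rfl⟩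
  · exact hF.imp fun a ha => ⟨ha, ha⟩
  · exact ⟨a, rfl, ha⟩

theorem IsSelectionPerRotation.exists_mem {F S : Set Alignment} (h : IsSelectionPerRotation F S)
    (hF : F.Nonempty) : ∃ a ∈ S, a ∈ F := by
  rcases h with ⟨-, hSF, hex⟩ | ⟨-, a, ha, rfl⟩
  · obtain ⟨a, ha⟩ := hF
    obtain ⟨t, ht, -⟩ := hex a.1 ⟨a, ha, rfl⟩
    exact ⟨_, ht, hSF ht⟩
  · exact ⟨a, rfl, ha⟩

/-- The alignment `a`, followed by a translation. -/
def Alignment.shift (a : Alignment) (x y : ℝ) : Alignment :=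
  Alignment.mk a.cos a.sin (a.2 0 + x) (a.2 1 + y) a.cos_sq_add_sin_sq

theorem Datum.res_shift (d : Datum) (a : Alignment) (x y : ℝ) :
    d.res (a.shift x y) = d.res a - (d.α * x + d.β * y) := by
  unfold res Alignment.shift
  simp only [Alignment.mk_cos, Alignment.mk_sin, Alignment.mk_snd_zero, Alignment.mk_snd_one]
  ring

/-- Among the minimizers of finitely many affine functions on the circle, the one closest to `x`
increases none of them by a factor of more than `4`. -/
theorem exists_nearest {ι : Type*} [Finite ι] (A B G : ι → ℝ) {x : ℝ × ℝ} (hx : x ∈ circle) :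
    (∀ i, A i ^ 2 + B i ^ 2 = 0) ∨
      ∃ i, A i ^ 2 + B i ^ 2 ≠ 0 ∧ ∃ y ∈ circMin (A i) (B i) (G i),
        ∀ k, |A k * y.1 + B k * y.2 - G k| ≤ 4 * |A k * x.1 + B k * x.2 - G k| := by
  by_cases hall : ∀ i, A i ^ 2 + B i ^ 2 = 0
  · exact Or.inl hall
  push Not at hall
  obtain ⟨i₀, hi₀⟩ := hall
  right
  -- Constant functions are left out: the whole circle minimizes them, and `M` would be infinite.
  -- They need no control, since their values never change.
  set M : Set (ℝ × ℝ) := ⋃ i ∈ {i | A i ^ 2 + B i ^ 2 ≠ 0}, circMin (A i) (B i) (G i) with hM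
  have hfin : M.Finite := (Set.toFinite _).biUnion fun i hi => by
    rw [circMin_eq hi]
    exact Set.toFinite _
  have hne : M.Nonempty :=
    ⟨_, Set.mem_biUnion (show i₀ ∈ {i | A i ^ 2 + B i ^ 2 ≠ 0} from hi₀)
      (circSol_mem (Or.inl rfl) (A i₀) (B i₀) (G i₀))⟩
  obtain ⟨y, hy, hmin⟩ := Set.exists_min_image M (sqd x) hfin hne
  obtain ⟨i, hi, hyi⟩ := Set.mem_iUnion₂.1 hy
  exact ⟨i, hi, y, hyi, fun k => abs_le_four_mul hx hyi.1 fun hk z hz =>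
    hmin z (Set.mem_biUnion (show k ∈ {i | A i ^ 2 + B i ^ 2 ≠ 0} from hk) hz)⟩

section Approximation

variable {n : ℕ} {D : Fin n → Datum} (hD : ∀ i, (D i).α ^ 2 + (D i).β ^ 2 = 1)

include hD

/-- Choose the pair with the smallest defect and translate by that defect along its unit normal.
Every other defect changes by at most this amount, as inner products of unit normals are at most 1
in absolute value. -/
theorem exists_on_first (hn : 0 < n) (a' : Alignment) :
    ∃ j, ∃ a : Alignment, (D j).res a = 0 ∧ ∀ i, |(D i).res a| ≤ 2 * |(D i).res a'| := by
  have : Nonempty (Fin n) := ⟨⟨0, hn⟩⟩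
  obtain ⟨j, hj⟩ := Finite.exists_min fun i => |(D i).res a'|
  refine ⟨j, a'.shift ((D j).res a' * (D j).α) ((D j).res a' * (D j).β), ?_, fun i => ?_⟩
  · rw [Datum.res_shift]
    linear_combination (-(D j).res a') * hD j
  · rw [Datum.res_shift]
    have hle : |(D i).α * (D j).α + (D i).β * (D j).β| ≤ 1 := by
      rw [← sq_le_one_iff_abs_le_one]
      nlinarith [sq_nonneg ((D i).α * (D j).β - (D i).β * (D j).α), hD i, hD j]
    have e : (D i).α * ((D j).res a' * (D j).α) + (D i).β * ((D j).res a' * (D j).β) =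
        ((D i).α * (D j).α + (D i).β * (D j).β) * (D j).res a' := by ring
    rw [e]
    refine (abs_sub _ _).trans ?_
    rw [abs_mul]
    have := mul_le_mul hle (hj i) (abs_nonneg _) zero_le_one
    linarith

omit hD in
-- A slide of length τ along the j-th line, in units of its normal vector, changes the i-th defect
-- by τ times the determinant of the normals. The pair k with the shortest slide is reached first,
-- so no change exceeds the defect itself; parallel lines see no change.
theorem exists_on_second {j k₀ : Fin n} (hk₀ : (D j).det (D k₀) ≠ 0) {a' : Alignment}
    (ha' : (D j).res a' = 0) :
    ∃ k, (D j).det (D k) ≠ 0 ∧ ∃ a : Alignment, (D j).res a = 0 ∧ (D k).res a = 0 ∧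
      ∀ i, |(D i).res a| ≤ 2 * |(D i).res a'| := by
  obtain ⟨k, hk, hmin⟩ := Set.exists_min_image {k | (D j).det (D k) ≠ 0}
    (fun k => |(D k).res a' / (D j).det (D k)|) (Set.toFinite _) ⟨k₀, hk₀⟩
  set τ := (D k).res a' / (D j).det (D k) with hτ
  have hres : ∀ i, (D i).res (a'.shift (-(D j).β * τ) ((D j).α * τ)) =
      (D i).res a' - τ * (D j).det (D i) := by
    intro i
    rw [Datum.res_shift]
    unfold Datum.det
    ring
  refine ⟨k, hk, a'.shift (-(D j).β * τ) ((D j).α * τ), ?_, ?_, fun i => ?_⟩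
  · rw [hres, ha', Datum.det]
    ring
  · rw [hres, hτ, div_mul_cancel₀ _ hk, sub_self]
  · rw [hres]
    by_cases hi : (D j).det (D i) = 0
    · rw [hi, mul_zero, sub_zero]
      linarith [abs_nonneg ((D i).res a')]
    · have h := hmin i hi
      rw [abs_div ((D i).res a'), le_div_iff₀ (abs_pos.2 hi), ← abs_mul] at h
      linarith [abs_sub ((D i).res a') (τ * (D j).det (D i))]

variable (hn : 2 ≤ n) {S : Fin n → Fin n → Fin n → Set Alignment}
  (hcross : ∀ j k l, j ≠ k → (D j).det (D k) ≠ 0 →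
    IsSelection (Datum.crossSet (D j) (D k) (D l)) (S j k l))
  (hslide : ∀ j k l, j ≠ k → (D j).det (D k) = 0 →
    IsSelectionPerRotation (Datum.slideSet (D j) (D k)) (S j k l))

include hn hcross hslide

theorem exists_selected (a' : Alignment) :
    ∃ j k l, j ≠ k ∧ ∃ a ∈ S j k l, ∀ i, |(D i).res a| ≤ 16 * |(D i).res a'| := by
  obtain ⟨j, a₁, hj₁, h₁⟩ := exists_on_first hD (by omega) a'
  -- In the parallel case the factor is only 2 · 4 = 8.
  by_cases hpar : ∀ k, (D j).det (D k) = 0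
  · have hpos : 0 < (D j).α ^ 2 + (D j).β ^ 2 := by rw [hD j]; exact one_pos
    have hfin : ∀ a : Alignment, (D j).res a = 0 →
        (∀ k : {k // k ≠ j}, |(Frame.slide (D j)).A (D j) (D k) (D k) * a.rot.1 +
          (Frame.slide (D j)).B (D j) (D k) (D k) * a.rot.2 -
            (Frame.slide (D j)).G (D j) (D k) (D k)| ≤
          4 * |(Frame.slide (D j)).A (D j) (D k) (D k) * a₁.rot.1 +
          (Frame.slide (D j)).B (D j) (D k) (D k) * a₁.rot.2 -
            (Frame.slide (D j)).G (D j) (D k) (D k)|) →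
        ∀ i, |(D i).res a| ≤ 16 * |(D i).res a'| := by
      intro a ha h i
      by_cases hi : i = j
      · rw [hi, ha, abs_zero]
        positivity
      · have h2 := h ⟨i, hi⟩
        simp only at h2
        rw [← Frame.res_of_parallel hpos (hpar i) ha,
          ← Frame.res_of_parallel hpos (hpar i) hj₁] at h2
        linarith [h₁ i, abs_nonneg ((D i).res a')]
    rcases exists_nearest (ι := {k // k ≠ j})
      (fun k => (Frame.slide (D j)).A (D j) (D k) (D k))
      (fun k => (Frame.slide (D j)).B (D j) (D k) (D k))
      (fun k => (Frame.slide (D j)).G (D j) (D k) (D k)) a₁.rot_mem with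
      hall | ⟨⟨k, hk⟩, hN, y, hy, hle⟩
    -- All functions are constant, so every rotation is as good as any other; the third index is
    -- arbitrary.
    · have : Nontrivial (Fin n) := Fin.nontrivial_iff_two_le.2 hn
      obtain ⟨k, hk⟩ := exists_ne j
      obtain ⟨a, haS, ha⟩ := (hslide j k j hk.symm (hpar k)).exists_mem
        ⟨_, Frame.best_mem_slideSet hpos (hpar k) 1⟩
      exact ⟨j, k, j, hk.symm, a, haS, hfin a ha.1 fun i =>
        abs_le_four_mul a₁.rot_mem a.rot_mem fun h => absurd (hall i) h⟩
    · have hmem : (Frame.slide (D j)).al (D j) (D k) hy.1 ∈ Datum.slideSet (D j) (D k) :=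
        (Frame.mem_slideSet hpos (hpar k) _).2
          ⟨Frame.res_slide (d₂ := D k) hpos rfl rfl, hy⟩
      -- The selected alignment with rotation `y` may have another translation; the defects do not
      -- depend on it.
      rcases hslide j k j hk.symm (hpar k) with ⟨-, hSF, hex⟩ | ⟨hinf, -⟩
      · obtain ⟨t, ht, -⟩ := hex _ ⟨_, hmem, rfl⟩
        exact ⟨j, k, j, hk.symm, _, ht, hfin _ (hSF ht).1 hle⟩
      · exact absurd (Frame.slideSet_finite hpos (hpar k) hN) hinf
  · push Not at hpar
    obtain ⟨k₀, hk₀⟩ := hpar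
    obtain ⟨k, hk, a₂, hj₂, hk₂, h₂⟩ := exists_on_second hk₀ hj₁
    have hjk : j ≠ k := by
      rintro rfl
      exact hk (by unfold Datum.det; ring)
    set F := Frame.cross (D j) (D k) with hF
    have ha₂ := (Frame.cross_iff hk a₂).1 ⟨hj₂, hk₂⟩
    have hfin : ∀ a : Alignment, (D j).res a = 0 → (D k).res a = 0 →
        (∀ l, |F.A (D j) (D k) (D l) * a.rot.1 + F.B (D j) (D k) (D l) * a.rot.2 -
            F.G (D j) (D k) (D l)| ≤
          4 * |F.A (D j) (D k) (D l) * a₂.rot.1 + F.B (D j) (D k) (D l) * a₂.rot.2 -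
            F.G (D j) (D k) (D l)|) →
        ∀ i, |(D i).res a| ≤ 16 * |(D i).res a'| := by
      intro a haj hak h i
      have ha := (Frame.cross_iff hk a).1 ⟨haj, hak⟩
      have h3 := h i
      rw [← Frame.res_of_eq ha.1 ha.2, ← Frame.res_of_eq ha₂.1 ha₂.2] at h3
      linarith [h₁ i, h₂ i]
    rcases exists_nearest (fun l => F.A (D j) (D k) (D l)) (fun l => F.B (D j) (D k) (D l))
      (fun l => F.G (D j) (D k) (D l)) a₂.rot_mem with hall | ⟨l, hN, y, hy, hle⟩
    · obtain ⟨a, haS, ha⟩ := (hcross j k j hjk hk).exists_mem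
        ⟨_, Frame.best_mem_crossSet hk 1⟩
      exact ⟨j, k, j, hjk, a, haS, hfin a ha.1 ha.2.1 fun i =>
        abs_le_four_mul a₂.rot_mem a.rot_mem fun h => absurd (hall i) h⟩
    · have hmem : F.al (D j) (D k) hy.1 ∈ Datum.crossSet (D j) (D k) (D l) :=
        (Frame.mem_crossSet hk _).2 ⟨⟨rfl, rfl⟩, hy⟩
      rcases hcross j k l hjk hk with ⟨-, hSF⟩ | ⟨hinf, -⟩
      · refine ⟨j, k, l, hjk, F.al (D j) (D k) hy.1, hSF ▸ hmem, hfin _ hmem.1 hmem.2.1 hle⟩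
      · rw [Frame.crossSet_eq hk hN] at hinf
        exact absurd (Set.toFinite _) hinf

end Approximation

theorem finite_and_ncard_le {n : ℕ} {S : Fin n → Fin n → Fin n → Set Alignment}
    (hS : ∀ j k l, j ≠ k → (S j k l).Finite ∧ (S j k l).ncard ≤ 2) :
    {a | ∃ j k l, j ≠ k ∧ a ∈ S j k l}.Finite ∧
      {a | ∃ j k l, j ≠ k ∧ a ∈ S j k l}.ncard ≤ 2 * n ^ 3 := by
  classical
  set T : Fin n × Fin n × Fin n → Set Alignment :=
    fun q => if q.1 ≠ q.2.1 then S q.1 q.2.1 q.2.2 else ∅ with hT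
  have hTfin : ∀ q, (T q).Finite ∧ (T q).ncard ≤ 2 := by
    intro q
    by_cases h : q.1 ≠ q.2.1
    · simp only [hT, if_pos h]
      exact hS _ _ _ h
    · simp only [hT, if_neg h]
      exact ⟨Set.finite_empty, by rw [Set.ncard_empty]; norm_num⟩
  have e : {a | ∃ j k l, j ≠ k ∧ a ∈ S j k l} = ⋃ q, T q := by
    ext a
    simp only [Set.mem_ofPred_eq, Set.mem_iUnion]
    constructor
    · rintro ⟨j, k, l, h, ha⟩
      refine ⟨(j, k, l), ?_⟩
      simp only [hT, if_pos h]
      exact ha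
    · rintro ⟨⟨j, k, l⟩, ha⟩
      by_cases h : j ≠ k
      · simp only [hT, if_pos h] at ha
        exact ⟨j, k, l, h, ha⟩
      · simp [hT] at ha
        exact absurd ha.1 h
  rw [e]
  refine ⟨Set.finite_iUnion fun q => (hTfin q).1, ?_⟩
  refine (Set.ncard_iUnion_le_of_fintype T).trans ?_
  refine (Finset.sum_le_sum fun q _ => (hTfin q).2).trans (le_of_eq ?_)
  rw [Finset.sum_const, Finset.card_univ, Fintype.card_prod, Fintype.card_prod, Fintype.card_fin,
    smul_eq_mul]
  ring

theorem IsAlignOutput.guarantee {n : ℕ} (hn : 2 ≤ n) {p : Fin n → Plane}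
    {ℓ : Fin n → AffineSubspace ℝ Plane} {C : Set Alignment} (hC : IsAlignOutput p ℓ C) :
    (∀ a' : Alignment, ∃ a ∈ C, ∀ i,
      lineDist (a.app (p i)) (ℓ i) ≤ 16 * lineDist (a'.app (p i)) (ℓ i)) ∧
    C.Finite ∧ C.ncard ≤ 2 * n ^ 3 := by
  obtain ⟨v, b, S, hnf, hcr, hsl, rfl⟩ := hC
  set D := normalDatum p v b with hDdef
  have hdesc : ∀ i, (D i).Describes (p i) (ℓ i) := fun i => hnf.describes i
  have hD : ∀ i, (D i).α ^ 2 + (D i).β ^ 2 = 1 := fun i => hnf.sq_add_sq i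
  have hdet : ∀ j k, |inner ℝ (v j) (v k)| = 1 ↔ (D j).det (D k) = 0 := fun j k =>
    hnf.abs_inner_eq_one_iff j k
  have hcross : ∀ j k l, j ≠ k → (D j).det (D k) ≠ 0 →
      IsSelection (Datum.crossSet (D j) (D k) (D l)) (S j k l) := by
    intro j k l hjk h
    have h' := mt (hdet j k).1 h
    rw [← hnf.crossing_eq h' hdesc l]
    exact hcr j k l hjk h'
  have hslide : ∀ j k l, j ≠ k → (D j).det (D k) = 0 →
      IsSelectionPerRotation (Datum.slideSet (D j) (D k)) (S j k l) := by
    intro j k l hjk h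
    rw [← Datum.sliding_eq hdesc j k]
    exact hsl j k l hjk ((hdet j k).2 h)
  constructor
  · intro a'
    obtain ⟨j, k, l, hjk, a, ha, h⟩ := exists_selected hD hn hcross hslide a'
    refine ⟨a, ⟨j, k, l, hjk, ha⟩, fun i => ?_⟩
    rw [(hdesc i).lineDist_eq, (hdesc i).lineDist_eq, hD i, Real.sqrt_one, div_one, div_one]
    exact h i
  · refine finite_and_ncard_le fun j k l hjk => ?_
    by_cases h : (D j).det (D k) = 0
    · exact Frame.ncard_of_isSelectionPerRotation (by rw [hD j]; exact one_pos) h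
        (hslide j k l hjk h)
    · exact Frame.ncard_of_isSelection h (hcross j k l hjk h)

/-! ### Reasoning about programs of the real RAM -/

/-- Started in `σ`, the program halts after at most `K` steps in a state that satisfies `Q`. -/
def Runs (c : Prog) (σ : State) (K : ℕ) (Q : State → Prop) : Prop :=
  ∃ k σ', Exec c σ k σ' ∧ k ≤ K ∧ Q σ'

/-- The running time of a program without loops is at most this number. -/
def Prog.bound : Prog → ℕ
  | .skip => 1
  | .setNat _ e => e.cost + 1
  | .setReal _ e => e.cost + 1
  | .store addr e => addr.cost + e.cost + 1
  | .seq c d => c.bound + d.bound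
  | .cond t c d => t.cost + (c.bound + d.bound)
  | .loop _ _ => 0

namespace Runs

variable {σ : State} {Q Q' : State → Prop} {c d : Prog} {K K' : ℕ}

theorem mono (h : Runs c σ K Q) (hK : K ≤ K') (hQ : ∀ τ, Q τ → Q' τ) : Runs c σ K' Q' := by
  obtain ⟨k, τ, he, hk, hq⟩ := h
  exact ⟨k, τ, he, hk.trans hK, hQ τ hq⟩

theorem skip (h : Q σ) : Runs .skip σ Prog.skip.bound Q := ⟨_, _, .skip σ, le_rfl, h⟩

theorem setNat {i : ℕ} {e : NExp}
    (h : Q { σ with nat := Function.update σ.nat i (e.eval σ) }) :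
    Runs (.setNat i e) σ (Prog.setNat i e).bound Q := ⟨_, _, .setNat i e σ, le_rfl, h⟩

theorem setReal {i : ℕ} {e : RExp}
    (h : Q { σ with real := Function.update σ.real i (e.eval σ) }) :
    Runs (.setReal i e) σ (Prog.setReal i e).bound Q := ⟨_, _, .setReal i e σ, le_rfl, h⟩

theorem store {a : NExp} {e : RExp}
    (h : Q { σ with mem := Function.update σ.mem (a.eval σ) (e.eval σ) }) :
    Runs (.store a e) σ (Prog.store a e).bound Q := ⟨_, _, .store a e σ, le_rfl, h⟩

theorem seq' (h₁ : Runs c σ K Q) (h₂ : ∀ τ, Q τ → Runs d τ K' Q') :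
    Runs (.seq c d) σ (K + K') Q' := by
  obtain ⟨k, τ, he, hk, hq⟩ := h₁
  obtain ⟨m, υ, he', hm, hq'⟩ := h₂ τ hq
  exact ⟨_, _, .seq he he', add_le_add hk hm, hq'⟩

theorem seq (h₁ : Runs c σ c.bound Q) (h₂ : ∀ τ, Q τ → Runs d τ d.bound Q') :
    Runs (.seq c d) σ (Prog.seq c d).bound Q' :=
  seq' h₁ h₂

theorem cond {t : BExp} (h₁ : t.holds σ → Runs c σ c.bound Q)
    (h₂ : ¬ t.holds σ → Runs d σ d.bound Q) : Runs (.cond t c d) σ (Prog.cond t c d).bound Q := by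
  by_cases ht : t.holds σ
  · obtain ⟨k, τ, he, hk, hq⟩ := h₁ ht
    exact ⟨_, _, .condTrue ht he, by simp only [Prog.bound]; omega, hq⟩
  · obtain ⟨k, τ, he, hk, hq⟩ := h₂ ht
    exact ⟨_, _, .condFalse ht he, by simp only [Prog.bound]; omega, hq⟩

/-- Symbolic execution on states split into components; the new value is supplied already evaluated.
-/
theorem seq_setNat {N : ℕ → ℕ} {R M : ℕ → ℝ} {i v : ℕ} {e : NExp} (he : e.eval ⟨N, R, M⟩ = v)
    (h : Runs d ⟨Function.update N i v, R, M⟩ d.bound Q) :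
    Runs (.seq (.setNat i e) d) ⟨N, R, M⟩ (Prog.seq (.setNat i e) d).bound Q := by
  subst he
  exact seq (setNat (Q := (· = _)) rfl) (by rintro _ rfl; exact h)

theorem seq_setReal {N : ℕ → ℕ} {R M : ℕ → ℝ} {i : ℕ} {v : ℝ} {e : RExp}
    (he : e.eval ⟨N, R, M⟩ = v) (h : Runs d ⟨N, Function.update R i v, M⟩ d.bound Q) :
    Runs (.seq (.setReal i e) d) ⟨N, R, M⟩ (Prog.seq (.setReal i e) d).bound Q := by
  subst he
  exact seq (setReal (Q := (· = _)) rfl) (by rintro _ rfl; exact h)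

theorem seq_store {N : ℕ → ℕ} {R M : ℕ → ℝ} {q : ℕ} {v : ℝ} {a : NExp} {e : RExp}
    (ha : a.eval ⟨N, R, M⟩ = q) (he : e.eval ⟨N, R, M⟩ = v)
    (h : Runs d ⟨N, R, Function.update M q v⟩ d.bound Q) :
    Runs (.seq (.store a e) d) ⟨N, R, M⟩ (Prog.seq (.store a e) d).bound Q := by
  subst he ha
  exact seq (store (Q := (· = _)) rfl) (by rintro _ rfl; exact h)

end Runs

/-- `for i in 0, …, n - 1 do c`, where `n` is in register `0`. -/
def forLoop (i : ℕ) (c : Prog) : Prog :=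
  .seq (.setNat i (.const 0))
    (.loop (.natLt (.var i) (.var 0)) (.seq c (.setNat i (.add (.var i) (.const 1)))))

/-- `P m` holds at the loop head and `P' m` after the body, before the counter is increased. A round
costs B + 7, for test, body and increment; initialization and the final test cost 5 more, which the
slack in B + 20 absorbs since n ≥ 1. -/
theorem Runs.forLoop {i n B : ℕ} {c : Prog} {σ : State} {P P' : ℕ → State → Prop} (hn : 1 ≤ n)
    (hP : ∀ m τ, P m τ → τ.nat i = m ∧ τ.nat 0 = n) (hP' : ∀ m τ, P' m τ → τ.nat i = m)
    (h0 : P 0 { σ with nat := Function.update σ.nat i 0 })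
    (hbody : ∀ m < n, ∀ τ, P m τ → Runs c τ B (P' m))
    (hinc : ∀ m τ, P' m τ → P (m + 1) { τ with nat := Function.update τ.nat i (m + 1) }) :
    Runs (forLoop i c) σ (n * (B + 20)) (P n) := by
  have hloop : ∀ r m, m + r = n → ∀ τ, P m τ → Runs (.loop (.natLt (.var i) (.var 0))
      (.seq c (.setNat i (.add (.var i) (.const 1))))) τ (r * (B + 7) + 3) (P n) := by
    -- Induction on the number of remaining rounds.
    intro r
    induction r with
    | zero =>
      intro m hm τ hτ
      obtain ⟨e1, e2⟩ := hP m τ hτ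
      obtain rfl : m = n := hm
      refine ⟨_, τ, .loopFalse ?_, by simp [BExp.cost, NExp.cost], hτ⟩
      simp [BExp.holds, NExp.eval, e1, e2]
    | succ r ih =>
      intro m hm τ hτ
      obtain ⟨e1, e2⟩ := hP m τ hτ
      obtain ⟨k, υ, he, hk, hq⟩ := hbody m (by omega) τ hτ
      have e3 := hP' m υ hq
      have hstep : NExp.eval υ (.add (.var i) (.const 1)) = m + 1 := by simp [NExp.eval, e3]
      have he2 := Exec.setNat i (.add (.var i) (.const 1)) υ
      rw [hstep] at he2
      obtain ⟨k', ω, he', hk', hq'⟩ := ih (m + 1) (by omega) _ (hinc m υ hq)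
      refine ⟨_, ω, .loopTrue ?_ (.seq he he2) he', ?_, hq'⟩
      · simp only [BExp.holds, NExp.eval, e1, e2]
        omega
      · simp only [BExp.cost, NExp.cost]
        rw [Nat.succ_mul]
        omega
  obtain ⟨k, τ, he, hk, hq⟩ := hloop n 0 (by omega) _ h0
  refine ⟨_, τ, .seq (.setNat i (.const 0) σ) he, ?_, hq⟩
  simp only [NExp.cost]
  nlinarith

/-! ### Expressions for the alignments -/

/-- With these operators the machine expressions copy the real formulas verbatim, so that several
evaluation lemmas below hold by `rfl`. -/
instance : Add RExp := ⟨.add⟩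
instance : Sub RExp := ⟨.sub⟩
instance : Mul RExp := ⟨.mul⟩
instance : Div RExp := ⟨.div⟩

@[simp] theorem RExp.eval_add' (σ : State) (e f : RExp) : (e + f).eval σ = e.eval σ + f.eval σ := rfl
@[simp] theorem RExp.eval_sub' (σ : State) (e f : RExp) : (e - f).eval σ = e.eval σ - f.eval σ := rfl
@[simp] theorem RExp.eval_mul' (σ : State) (e f : RExp) : (e * f).eval σ = e.eval σ * f.eval σ := rfl
@[simp] theorem RExp.eval_div' (σ : State) (e f : RExp) : (e / f).eval σ = e.eval σ / f.eval σ := rfl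
@[simp] theorem RExp.eval_sqrt' (σ : State) (e : RExp) : (RExp.sqrt e).eval σ = √(e.eval σ) := rfl
@[simp] theorem RExp.eval_const' (σ : State) (c : ℤ) : (RExp.const c).eval σ = c := rfl

/-- Equality of reals as a test. -/
def BExp.realEq (e f : RExp) : BExp := .and (.not (.realLt e f)) (.not (.realLt f e))

theorem BExp.holds_realEq (σ : State) (e f : RExp) :
    (BExp.realEq e f).holds σ ↔ e.eval σ = f.eval σ := by
  simp only [realEq, holds, not_lt]
  exact ⟨fun h => le_antisymm h.2 h.1, fun h => ⟨h.ge, h.le⟩⟩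

/-- Equality of integers as a test. -/
def BExp.natEq (e f : NExp) : BExp := .and (.not (.natLt e f)) (.not (.natLt f e))

theorem BExp.holds_natEq (σ : State) (e f : NExp) :
    (BExp.natEq e f).holds σ ↔ e.eval σ = f.eval σ := by
  simp only [natEq, holds, not_lt]
  exact ⟨fun h => le_antisymm h.2 h.1, fun h => ⟨h.ge, h.le⟩⟩

/-- Five times an integer. -/
def NExp.five (e : NExp) : NExp := .add e (.add e (.add e (.add e e)))

theorem NExp.eval_five (σ : State) (e : NExp) : (NExp.five e).eval σ = 5 * e.eval σ := by
  simp only [five, eval]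
  omega

/-- Expressions for the entries of a datum. -/
structure DExp where
  x : RExp
  y : RExp
  α : RExp
  β : RExp
  γ : RExp

def DExp.eval (σ : State) (d : DExp) : Datum :=
  ⟨d.x.eval σ, d.y.eval σ, d.α.eval σ, d.β.eval σ, d.γ.eval σ⟩

/-- The input pair whose index is in register `r`. -/
def DExp.input (r : ℕ) : DExp where
  x := .load (.five (.var r))
  y := .load (.add (.five (.var r)) (.const 1))
  α := .load (.add (.five (.var r)) (.const 2))
  β := .load (.add (.five (.var r)) (.const 3))
  γ := .load (.add (.five (.var r)) (.const 4))

/-- The determinant of the normal vectors. -/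
def DExp.det (d₁ d₂ : DExp) : RExp := d₁.α * d₂.β - d₂.α * d₁.β

/-- The offset of the rotated point from its line. -/
def DExp.off (d : DExp) (c s : RExp) : RExp :=
  (d.α * d.x + d.β * d.y) * c + (d.β * d.x - d.α * d.y) * s - d.γ

/-- Expressions for the coefficients of a family of alignments. -/
structure FExp where
  U₀ : RExp
  U₁ : RExp
  W₀ : RExp
  W₁ : RExp

namespace FExp

def eval (σ : State) (F : FExp) : Frame := ⟨F.U₀.eval σ, F.U₁.eval σ, F.W₀.eval σ, F.W₁.eval σ⟩

def cross (d₁ d₂ : DExp) : FExp :=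
  ⟨d₂.β / d₁.det d₂, (.const 0 - d₂.α) / d₁.det d₂, (.const 0 - d₁.β) / d₁.det d₂,
    d₁.α / d₁.det d₂⟩

def slide (d : DExp) : FExp :=
  ⟨d.α / (d.α * d.α + d.β * d.β), d.β / (d.α * d.α + d.β * d.β), .const 0, .const 0⟩

variable (F : FExp) (d₁ d₂ d₃ : DExp)

def A : RExp := (d₃.α * d₃.x + d₃.β * d₃.y) -
  (d₃.α * F.U₀ + d₃.β * F.U₁) * (d₁.α * d₁.x + d₁.β * d₁.y) -
  (d₃.α * F.W₀ + d₃.β * F.W₁) * (d₂.α * d₂.x + d₂.β * d₂.y)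

def B : RExp := (d₃.β * d₃.x - d₃.α * d₃.y) -
  (d₃.α * F.U₀ + d₃.β * F.U₁) * (d₁.β * d₁.x - d₁.α * d₁.y) -
  (d₃.α * F.W₀ + d₃.β * F.W₁) * (d₂.β * d₂.x - d₂.α * d₂.y)

def G : RExp :=
  d₃.γ - (d₃.α * F.U₀ + d₃.β * F.U₁) * d₁.γ - (d₃.α * F.W₀ + d₃.β * F.W₁) * d₂.γ

def t₀ (c s : RExp) : RExp := d₁.off c s * F.U₀ + d₂.off c s * F.W₀

def t₁ (c s : RExp) : RExp := d₁.off c s * F.U₁ + d₂.off c s * F.W₁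

theorem eval_cross (σ : State) :
    (cross d₁ d₂).eval σ = Frame.cross (d₁.eval σ) (d₂.eval σ) := by
  simp [eval, cross, Frame.cross, DExp.eval, DExp.det, Datum.det]

theorem eval_slide (σ : State) : (slide d₁).eval σ = Frame.slide (d₁.eval σ) := by
  simp [eval, slide, Frame.slide, DExp.eval, sq]

theorem eval_A (σ : State) :
    (F.A d₁ d₂ d₃).eval σ = (F.eval σ).A (d₁.eval σ) (d₂.eval σ) (d₃.eval σ) := rfl

theorem eval_B (σ : State) :
    (F.B d₁ d₂ d₃).eval σ = (F.eval σ).B (d₁.eval σ) (d₂.eval σ) (d₃.eval σ) := rfl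

theorem eval_G (σ : State) :
    (F.G d₁ d₂ d₃).eval σ = (F.eval σ).G (d₁.eval σ) (d₂.eval σ) (d₃.eval σ) := rfl

theorem eval_t₀ (c s : RExp) (σ : State) : (F.t₀ d₁ d₂ c s).eval σ =
    (F.eval σ).t₀ (d₁.eval σ) (d₂.eval σ) (c.eval σ, s.eval σ) := rfl

theorem eval_t₁ (c s : RExp) (σ : State) : (F.t₁ d₁ d₂ c s).eval σ =
    (F.eval σ).t₁ (d₁.eval σ) (d₂.eval σ) (c.eval σ, s.eval σ) := rfl

end FExp

/-! ### The program -/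

/-- Append the alignment with the given cosine, sine and translation to the output; register `4`
holds the next free address, register `5` the length of the output. -/
def emit (c s t₀ t₁ : RExp) : Prog :=
  .seq (.setReal 0 c) <| .seq (.setReal 1 s) <| .seq (.setReal 2 t₀) <| .seq (.setReal 3 t₁) <|
  .seq (.store (.var 4) (.var 0)) <|
  .seq (.store (.add (.var 4) (.const 1)) (.sub (.const 0) (.var 1))) <|
  .seq (.store (.add (.var 4) (.const 2)) (.var 1)) <|
  .seq (.store (.add (.var 4) (.const 3)) (.var 0)) <|
  .seq (.store (.add (.var 4) (.const 4)) (.var 2)) <|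
  .seq (.store (.add (.var 4) (.const 5)) (.var 3)) <|
  .seq (.setNat 4 (.add (.var 4) (.const 6))) (.setNat 5 (.add (.var 5) (.const 1)))

/-- Append the member of a family with the given rotation to the output. -/
def FExp.emit (F : FExp) (d₁ d₂ : DExp) (c s : RExp) : Prog :=
  PointsToLines.emit c s (F.t₀ d₁ d₂ c s) (F.t₁ d₁ d₂ c s)

/-- Append the members of a family whose rotations minimize `|A c + B s - G|` to the output, where
`N = A ^ 2 + B ^ 2`. -/
def FExp.emitSol (F : FExp) (d₁ d₂ : DExp) (A B G N : RExp) : Prog :=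
  .cond (.realEq N (.const 0))
    (.seq (F.emit d₁ d₂ (.const 1) (.const 0)) (F.emit d₁ d₂ (.const 1) (.const 0))) <|
  .cond (.realLt N (G * G))
    (.cond (.realLt (.const 0) G)
      (.seq (F.emit d₁ d₂ (A / .sqrt N) (B / .sqrt N)) (F.emit d₁ d₂ (A / .sqrt N) (B / .sqrt N)))
      (.seq (F.emit d₁ d₂ (.const 0 - A / .sqrt N) (.const 0 - B / .sqrt N))
        (F.emit d₁ d₂ (.const 0 - A / .sqrt N) (.const 0 - B / .sqrt N))))
    (.seq (F.emit d₁ d₂ ((A * G - B * .sqrt (N - G * G)) / N) ((B * G + A * .sqrt (N - G * G)) / N))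
      (F.emit d₁ d₂ ((A * G + B * .sqrt (N - G * G)) / N) ((B * G - A * .sqrt (N - G * G)) / N)))

/-- Append the best two members of a family to the output. -/
def FExp.emitBest (F : FExp) (d₁ d₂ d₃ : DExp) : Prog :=
  F.emitSol d₁ d₂ (F.A d₁ d₂ d₃) (F.B d₁ d₂ d₃) (F.G d₁ d₂ d₃)
    (F.A d₁ d₂ d₃ * F.A d₁ d₂ d₃ + F.B d₁ d₂ d₃ * F.B d₁ d₂ d₃)

/-- The alignments of a triple; its indices are in the registers `1`, `2`, `3`. -/
def tripleProg : Prog :=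
  .cond (.natEq (.var 1) (.var 2)) .skip <|
  .cond (.realEq ((DExp.input 1).det (DExp.input 2)) (.const 0))
    ((FExp.slide (.input 1)).emitBest (.input 1) (.input 2) (.input 2))
    ((FExp.cross (.input 1) (.input 2)).emitBest (.input 1) (.input 2) (.input 3))

/-- The whole program. -/
def alignProg : Prog :=
  .seq (.setNat 4 (.five (.var 0))) <| .seq (.setNat 5 (.const 0)) <|
  .seq (forLoop 1 (forLoop 2 (forLoop 3 tripleProg))) <|
  .seq (.setNat 1 (.five (.var 0))) (.setNat 0 (.var 5))

/-! ### Correctness of the program -/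

/-- The six cells from address `q` on hold `a`. -/
def Cells (mem : ℕ → ℝ) (q : ℕ) (a : Alignment) : Prop :=
  mem q = a.1.1 0 0 ∧ mem (q + 1) = a.1.1 0 1 ∧ mem (q + 2) = a.1.1 1 0 ∧
  mem (q + 3) = a.1.1 1 1 ∧ mem (q + 4) = a.2 0 ∧ mem (q + 5) = a.2 1

/-- The state holds the input `D` and the indices `j`, `k`, `l`. -/
structure Reads (D : ℕ → Datum) (n j k l : ℕ) (σ : State) : Prop where
  size : σ.nat 0 = n
  fst : σ.nat 1 = j
  snd : σ.nat 2 = k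
  trd : σ.nat 3 = l
  input : ∀ i < n, σ.mem (5 * i) = (D i).x ∧ σ.mem (5 * i + 1) = (D i).y ∧
    σ.mem (5 * i + 2) = (D i).α ∧ σ.mem (5 * i + 3) = (D i).β ∧ σ.mem (5 * i + 4) = (D i).γ

/-- The state holds the input `D`, the indices `j`, `k`, `l` and the list `L`. -/
structure Inv (D : ℕ → Datum) (n j k l : ℕ) (L : List Alignment) (σ : State) : Prop
    extends Reads D n j k l σ where
  ptr : σ.nat 4 = 5 * n + 6 * L.length
  count : σ.nat 5 = L.length
  output : ∀ m a, L[m]? = some a → Cells σ.mem (5 * n + 6 * m) a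

variable {D : ℕ → Datum} {n j k l : ℕ} {L : List Alignment} {σ : State}

/-- The six writes start right behind the input and the earlier output, so both survive. The
expressions are evaluated while scratch registers are being overwritten, which is why their values
are required in every state that satisfies `Reads`. -/
theorem Inv.emit (h : Inv D n j k l L σ) {c s t₀ t₁ : RExp} {a : Alignment}
    (hc : ∀ τ, Reads D n j k l τ → c.eval τ = a.cos)
    (hs : ∀ τ, Reads D n j k l τ → s.eval τ = a.sin)
    (h₀ : ∀ τ, Reads D n j k l τ → t₀.eval τ = a.2 0)
    (h₁ : ∀ τ, Reads D n j k l τ → t₁.eval τ = a.2 1) :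
    Runs (emit c s t₀ t₁) σ (PointsToLines.emit c s t₀ t₁).bound (Inv D n j k l (L ++ [a])) := by
  obtain ⟨hr, hp, hcnt, hout⟩ := h
  obtain ⟨N₀, R₀, M₀⟩ := σ
  simp only at hp hcnt hout
  -- The new invariant needs only agreement below the write address and on the first four integer
  -- registers, besides the new cells and the two updated counters.
  have key : ∀ (N : ℕ → ℕ) (R M : ℕ → ℝ), (∀ i < 4, N i = N₀ i) →
      N 4 = 5 * n + 6 * L.length + 6 → N 5 = L.length + 1 →
      (∀ r < 5 * n + 6 * L.length, M r = M₀ r) → Cells M (5 * n + 6 * L.length) a →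
      Inv D n j k l (L ++ [a]) ⟨N, R, M⟩ := by
    intro N R M hN h4 h5 hM hcells
    refine ⟨⟨?_, ?_, ?_, ?_, fun i hi => ?_⟩, ?_, ?_, fun m b hb => ?_⟩
    · exact (hN 0 (by norm_num)).trans hr.size
    · exact (hN 1 (by norm_num)).trans hr.fst
    · exact (hN 2 (by norm_num)).trans hr.snd
    · exact (hN 3 (by norm_num)).trans hr.trd
    · simp only
      rw [hM _ (by omega), hM _ (by omega), hM _ (by omega), hM _ (by omega), hM _ (by omega)]
      exact hr.input i hi
    · simp only [h4, List.length_append, List.length_singleton]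
      omega
    · simp only [h5, List.length_append, List.length_singleton]
    · rcases Nat.lt_or_ge m L.length with hm | hm
      · rw [List.getElem?_append_left hm] at hb
        have := hout m b hb
        unfold Cells at this ⊢
        simp only
        rw [hM _ (by omega), hM _ (by omega), hM _ (by omega), hM _ (by omega), hM _ (by omega),
          hM _ (by omega)]
        exact this
      · rw [List.getElem?_append_right hm, List.getElem?_singleton] at hb
        split_ifs at hb with h0
        obtain rfl : m = L.length := by omega
        obtain rfl : a = b := by simpa using hb
        exact hcells
  obtain ⟨e11, e01, -⟩ := a.entries
  have hr' : ∀ R, Reads D n j k l ⟨N₀, R, M₀⟩ := fun R => ⟨hr.1, hr.2, hr.3, hr.4, hr.5⟩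
  set q := 5 * n + 6 * L.length with hq
  have hadd : ∀ R M i, NExp.eval ⟨N₀, R, M⟩ (.add (.var 4) (.const i)) = q + i := fun R M i => by
    simp only [NExp.eval, hp]
  unfold PointsToLines.emit
  refine Runs.seq_setReal (hc _ hr) <| Runs.seq_setReal (hs _ (hr' _)) <|
    Runs.seq_setReal (h₀ _ (hr' _)) <| Runs.seq_setReal (h₁ _ (hr' _)) ?_
  have r0 : ∀ M, RExp.eval ⟨N₀, Function.update (Function.update (Function.update (Function.update
      R₀ 0 a.cos) 1 a.sin) 2 (a.2 0)) 3 (a.2 1), M⟩ (.var 0) = a.cos := fun M => by simp [RExp.eval]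
  have r1 : ∀ M, RExp.eval ⟨N₀, Function.update (Function.update (Function.update (Function.update
      R₀ 0 a.cos) 1 a.sin) 2 (a.2 0)) 3 (a.2 1), M⟩ (.var 1) = a.sin := fun M => by simp [RExp.eval]
  have r2 : ∀ M, RExp.eval ⟨N₀, Function.update (Function.update (Function.update (Function.update
      R₀ 0 a.cos) 1 a.sin) 2 (a.2 0)) 3 (a.2 1), M⟩ (.var 2) = a.2 0 := fun M => by simp [RExp.eval]
  have r3 : ∀ M, RExp.eval ⟨N₀, Function.update (Function.update (Function.update (Function.update
      R₀ 0 a.cos) 1 a.sin) 2 (a.2 0)) 3 (a.2 1), M⟩ (.var 3) = a.2 1 := fun M => by simp [RExp.eval]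
  have r1' : ∀ M, RExp.eval ⟨N₀, Function.update (Function.update (Function.update (Function.update
      R₀ 0 a.cos) 1 a.sin) 2 (a.2 0)) 3 (a.2 1), M⟩ (.sub (.const 0) (.var 1)) = -a.sin :=
    fun M => by rw [RExp.eval, r1, RExp.eval_const', Int.cast_zero, zero_sub]
  refine Runs.seq_store (q := q) hp (r0 _) <| Runs.seq_store (hadd _ _ _) (r1' _) <|
    Runs.seq_store (hadd _ _ _) (r1 _) <| Runs.seq_store (hadd _ _ _) (r0 _) <|
    Runs.seq_store (hadd _ _ _) (r2 _) <| Runs.seq_store (hadd _ _ _) (r3 _) <|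
    Runs.seq_setNat (hadd _ _ _) ?_
  refine Runs.setNat (key _ _ _ ?_ ?_ ?_ ?_ ?_)
  · intro i hi
    simp only
    rw [Function.update_of_ne (by omega), Function.update_of_ne (by omega)]
  · simp
  · simp [NExp.eval, hcnt]
  · intro r hr
    simp only
    rw [Function.update_of_ne (by omega), Function.update_of_ne (by omega),
      Function.update_of_ne (by omega), Function.update_of_ne (by omega),
      Function.update_of_ne (by omega), Function.update_of_ne (by omega)]
  · unfold Cells
    rw [e11, e01]
    simp [Alignment.cos, Alignment.sin]

theorem Reads.eval_fst (h : Reads D n j k l σ) (hj : j < n) : (DExp.input 1).eval σ = D j := by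
  obtain ⟨h0, h1, h2, h3, h4⟩ := h.input j hj
  simp only [DExp.eval, DExp.input, RExp.eval, NExp.eval, NExp.eval_five, h.fst, h0, h1, h2, h3, h4]

theorem Reads.eval_snd (h : Reads D n j k l σ) (hk : k < n) : (DExp.input 2).eval σ = D k := by
  obtain ⟨h0, h1, h2, h3, h4⟩ := h.input k hk
  simp only [DExp.eval, DExp.input, RExp.eval, NExp.eval, NExp.eval_five, h.snd, h0, h1, h2, h3, h4]

theorem Reads.eval_trd (h : Reads D n j k l σ) (hl : l < n) : (DExp.input 3).eval σ = D l := by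
  obtain ⟨h0, h1, h2, h3, h4⟩ := h.input l hl
  simp only [DExp.eval, DExp.input, RExp.eval, NExp.eval, NExp.eval_five, h.trd, h0, h1, h2, h3, h4]

section Emit

variable {F : FExp} {e₁ e₂ e₃ : DExp} {F' : Frame} {d₁ d₂ d₃ : Datum}
  (hF : ∀ τ, Reads D n j k l τ → F.eval τ = F')
  (h₁ : ∀ τ, Reads D n j k l τ → e₁.eval τ = d₁)
  (h₂ : ∀ τ, Reads D n j k l τ → e₂.eval τ = d₂)

include hF h₁ h₂

theorem Inv.emit_al (h : Inv D n j k l L σ) {c s : RExp} {x : ℝ × ℝ} (hx : x ∈ circle)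
    (hcs : ∀ τ, Reads D n j k l τ → (c.eval τ, s.eval τ) = x) :
    Runs (F.emit e₁ e₂ c s) σ (F.emit e₁ e₂ c s).bound
      (Inv D n j k l (L ++ [F'.al d₁ d₂ hx])) := by
  unfold FExp.emit
  refine h.emit (fun τ hτ => ?_) (fun τ hτ => ?_) (fun τ hτ => ?_) (fun τ hτ => ?_)
  · exact congrArg Prod.fst (hcs τ hτ)
  · exact congrArg Prod.snd (hcs τ hτ)
  · rw [FExp.eval_t₀, hF τ hτ, h₁ τ hτ, h₂ τ hτ, hcs τ hτ]
    rfl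
  · rw [FExp.eval_t₁, hF τ hτ, h₁ τ hτ, h₂ τ hτ, hcs τ hτ]
    rfl

theorem Inv.emit_pair (h : Inv D n j k l L σ) {c s c' s' : RExp} {x y : ℝ × ℝ} (hx : x ∈ circle)
    (hy : y ∈ circle) (hcs : ∀ τ, Reads D n j k l τ → (c.eval τ, s.eval τ) = x)
    (hcs' : ∀ τ, Reads D n j k l τ → (c'.eval τ, s'.eval τ) = y) :
    Runs (.seq (F.emit e₁ e₂ c s) (F.emit e₁ e₂ c' s')) σ
      (Prog.seq (F.emit e₁ e₂ c s) (F.emit e₁ e₂ c' s')).bound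
      (Inv D n j k l (L ++ [F'.al d₁ d₂ hx, F'.al d₁ d₂ hy])) := by
  refine Runs.seq (h.emit_al hF h₁ h₂ hx hcs) fun τ hτ => ?_
  have := hτ.emit_al hF h₁ h₂ hy hcs'
  rwa [List.append_assoc] at this

/-- The branches of the program mirror those of `circSol`. Each appends two alignments, even equal
ones; repetitions do not matter, as the output is the range of the list. -/
theorem Inv.emit_sol (h : Inv D n j k l L σ) {A B G N : RExp} {A' B' G' : ℝ}
    (hA : ∀ τ, Reads D n j k l τ → A.eval τ = A') (hB : ∀ τ, Reads D n j k l τ → B.eval τ = B')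
    (hG : ∀ τ, Reads D n j k l τ → G.eval τ = G')
    (hN : ∀ τ, Reads D n j k l τ → N.eval τ = A' ^ 2 + B' ^ 2) {x y : ℝ × ℝ}
    (hx : x ∈ circle) (hy : y ∈ circle) (hx' : x = circSol 1 A' B' G')
    (hy' : y = circSol (-1) A' B' G') :
    Runs (F.emitSol e₁ e₂ A B G N) σ (F.emitSol e₁ e₂ A B G N).bound
      (Inv D n j k l (L ++ [F'.al d₁ d₂ hx, F'.al d₁ d₂ hy])) := by
  have hσ := h.toReads
  unfold FExp.emitSol
  refine Runs.cond (fun ht => ?_) fun ht => Runs.cond (fun ht' => ?_) fun ht' => ?_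
  · rw [BExp.holds_realEq, hN σ hσ, RExp.eval_const', Int.cast_zero] at ht
    refine h.emit_pair hF h₁ h₂ hx hy (fun τ hτ => ?_) (fun τ hτ => ?_)
    · rw [hx', circSol, if_pos ht]
      simp
    · rw [hy', circSol, if_pos ht]
      simp
  · rw [BExp.holds_realEq, hN σ hσ, RExp.eval_const', Int.cast_zero] at ht
    simp only [BExp.holds, RExp.eval_mul', hN σ hσ, hG σ hσ, ← sq] at ht'
    refine Runs.cond (fun hs => ?_) fun hs => ?_
    · simp only [BExp.holds, RExp.eval_const', Int.cast_zero, hG σ hσ] at hs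
      refine h.emit_pair hF h₁ h₂ hx hy (fun τ hτ => ?_) (fun τ hτ => ?_)
      · rw [hx', circSol, if_neg ht, if_pos ht', if_pos hs]
        simp [hA τ hτ, hB τ hτ, hN τ hτ]
      · rw [hy', circSol, if_neg ht, if_pos ht', if_pos hs]
        simp [hA τ hτ, hB τ hτ, hN τ hτ]
    · simp only [BExp.holds, RExp.eval_const', Int.cast_zero, hG σ hσ] at hs
      refine h.emit_pair hF h₁ h₂ hx hy (fun τ hτ => ?_) (fun τ hτ => ?_)
      · rw [hx', circSol, if_neg ht, if_pos ht', if_neg hs]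
        simp [hA τ hτ, hB τ hτ, hN τ hτ]
      · rw [hy', circSol, if_neg ht, if_pos ht', if_neg hs]
        simp [hA τ hτ, hB τ hτ, hN τ hτ]
  · rw [BExp.holds_realEq, hN σ hσ, RExp.eval_const', Int.cast_zero] at ht
    simp only [BExp.holds, RExp.eval_mul', hN σ hσ, hG σ hσ, ← sq] at ht'
    refine h.emit_pair hF h₁ h₂ hx hy (fun τ hτ => ?_) (fun τ hτ => ?_)
    · rw [hx', circSol, if_neg ht, if_neg ht']
      simp [hA τ hτ, hB τ hτ, hN τ hτ, hG τ hτ, sq]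
    · rw [hy', circSol, if_neg ht, if_neg ht']
      simp [hA τ hτ, hB τ hτ, hN τ hτ, hG τ hτ, sq, ← sub_eq_add_neg]

theorem Inv.emit_best (h : Inv D n j k l L σ)
    (h₃ : ∀ τ, Reads D n j k l τ → e₃.eval τ = d₃) :
    Runs (F.emitBest e₁ e₂ e₃) σ (F.emitBest e₁ e₂ e₃).bound
      (Inv D n j k l (L ++ [F'.best d₁ d₂ d₃ 1, F'.best d₁ d₂ d₃ (-1)])) := by
  have hA : ∀ τ, Reads D n j k l τ → (F.A e₁ e₂ e₃).eval τ = F'.A d₁ d₂ d₃ := fun τ hτ => by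
    rw [FExp.eval_A, hF τ hτ, h₁ τ hτ, h₂ τ hτ, h₃ τ hτ]
  have hB : ∀ τ, Reads D n j k l τ → (F.B e₁ e₂ e₃).eval τ = F'.B d₁ d₂ d₃ := fun τ hτ => by
    rw [FExp.eval_B, hF τ hτ, h₁ τ hτ, h₂ τ hτ, h₃ τ hτ]
  have hG : ∀ τ, Reads D n j k l τ → (F.G e₁ e₂ e₃).eval τ = F'.G d₁ d₂ d₃ := fun τ hτ => by
    rw [FExp.eval_G, hF τ hτ, h₁ τ hτ, h₂ τ hτ, h₃ τ hτ]
  unfold FExp.emitBest Frame.best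
  refine h.emit_sol hF h₁ h₂ hA hB hG (fun τ hτ => ?_) _ _ ?_ ?_
  · rw [RExp.eval_add', RExp.eval_mul', RExp.eval_mul', hA τ hτ, hB τ hτ]
    ring
  · simp
  · simp

end Emit

open Classical in
/-- The alignments that the program chooses for a triple. -/
def chosen (D : ℕ → Datum) (j k l : ℕ) : List Alignment :=
  if j = k then []
  else if (D j).det (D k) = 0 then
    [(Frame.slide (D j)).best (D j) (D k) (D k) 1, (Frame.slide (D j)).best (D j) (D k) (D k) (-1)]
  else
    [(Frame.cross (D j) (D k)).best (D j) (D k) (D l) 1,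
      (Frame.cross (D j) (D k)).best (D j) (D k) (D l) (-1)]

theorem Inv.triple (h : Inv D n j k l L σ) (hj : j < n) (hk : k < n) (hl : l < n) :
    Runs tripleProg σ tripleProg.bound (Inv D n j k l (L ++ chosen D j k l)) := by
  have h₁ : ∀ τ, Reads D n j k l τ → (DExp.input 1).eval τ = D j := fun τ hτ => hτ.eval_fst hj
  have h₂ : ∀ τ, Reads D n j k l τ → (DExp.input 2).eval τ = D k := fun τ hτ => hτ.eval_snd hk
  have h₃ : ∀ τ, Reads D n j k l τ → (DExp.input 3).eval τ = D l := fun τ hτ => hτ.eval_trd hl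
  have hdet : ((DExp.input 1).det (DExp.input 2)).eval σ = (D j).det (D k) := by
    rw [← h₁ σ h.toReads, ← h₂ σ h.toReads]
    rfl
  unfold tripleProg chosen
  refine Runs.cond (fun ht => ?_) fun ht => Runs.cond (fun ht' => ?_) fun ht' => ?_
  · rw [BExp.holds_natEq, NExp.eval, NExp.eval, h.fst, h.snd] at ht
    rw [if_pos ht, List.append_nil]
    exact Runs.skip h
  · rw [BExp.holds_natEq, NExp.eval, NExp.eval, h.fst, h.snd] at ht
    rw [BExp.holds_realEq, hdet, RExp.eval_const', Int.cast_zero] at ht'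
    rw [if_neg ht, if_pos ht']
    exact h.emit_best (fun τ hτ => by rw [FExp.eval_slide, h₁ τ hτ]) h₁ h₂ h₂
  · rw [BExp.holds_natEq, NExp.eval, NExp.eval, h.fst, h.snd] at ht
    rw [BExp.holds_realEq, hdet, RExp.eval_const', Int.cast_zero] at ht'
    rw [if_neg ht, if_neg ht']
    exact h.emit_best (fun τ hτ => by rw [FExp.eval_cross, h₁ τ hτ, h₂ τ hτ]) h₁ h₂ h₃

/-! ### Loop counters and the nested loops. -/

theorem Inv.set_fst (h : Inv D n j k l L σ) (j' : ℕ) :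
    Inv D n j' k l L { σ with nat := Function.update σ.nat 1 j' } :=
  ⟨⟨by simp [h.size], by simp, by simp [h.snd], by simp [h.trd], h.input⟩, by simp [h.ptr],
    by simp [h.count], h.output⟩

theorem Inv.set_snd (h : Inv D n j k l L σ) (k' : ℕ) :
    Inv D n j k' l L { σ with nat := Function.update σ.nat 2 k' } :=
  ⟨⟨by simp [h.size], by simp [h.fst], by simp, by simp [h.trd], h.input⟩, by simp [h.ptr],
    by simp [h.count], h.output⟩

theorem Inv.set_trd (h : Inv D n j k l L σ) (l' : ℕ) :
    Inv D n j k l' L { σ with nat := Function.update σ.nat 3 l' } :=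
  ⟨⟨by simp [h.size], by simp [h.fst], by simp [h.snd], by simp, h.input⟩, by simp [h.ptr],
    by simp [h.count], h.output⟩

theorem append_flatMap_range_succ {X : Type*} (L : List X) (f : ℕ → List X) (m : ℕ) :
    L ++ (List.range (m + 1)).flatMap f = (L ++ (List.range m).flatMap f) ++ f m := by
  rw [List.range_succ, List.flatMap_append, List.flatMap_singleton, List.append_assoc]

theorem Inv.loop_trd (h : Inv D n j k l L σ) (hn : 1 ≤ n) (hj : j < n) (hk : k < n) :
    Runs (forLoop 3 tripleProg) σ (n * (tripleProg.bound + 20))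
      (fun τ => ∃ l', Inv D n j k l' (L ++ (List.range n).flatMap (chosen D j k)) τ) := by
  refine Runs.mono (Runs.forLoop (n := n)
    (P := fun m => Inv D n j k m (L ++ (List.range m).flatMap (chosen D j k)))
    (P' := fun m => Inv D n j k m (L ++ (List.range (m + 1)).flatMap (chosen D j k)))
    hn (fun m τ hτ => ⟨hτ.trd, hτ.size⟩) (fun m τ hτ => hτ.trd) ?_ (fun m hm τ hτ => ?_)
    (fun m τ hτ => hτ.set_trd (m + 1))) le_rfl (fun τ hτ => ⟨n, hτ⟩)
  · simpa using h.set_trd 0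
  · rw [append_flatMap_range_succ]
    exact hτ.triple hj hk hm

/-- The inner loop leaves its counter at a value of no interest, hence the existential quantifiers
in the invariants. -/
theorem Inv.loop_snd (h : Inv D n j k l L σ) (hn : 1 ≤ n) (hj : j < n) :
    Runs (forLoop 2 (forLoop 3 tripleProg)) σ (n * (n * (tripleProg.bound + 20) + 20))
      (fun τ => ∃ k' l', Inv D n j k' l' (L ++ (List.range n).flatMap fun k =>
        (List.range n).flatMap (chosen D j k)) τ) := by
  refine Runs.mono (Runs.forLoop (n := n)
    (P := fun m τ => ∃ l', Inv D n j m l' (L ++ (List.range m).flatMap fun k =>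
        (List.range n).flatMap (chosen D j k)) τ)
    (P' := fun m τ => ∃ l', Inv D n j m l' (L ++ (List.range (m + 1)).flatMap fun k =>
        (List.range n).flatMap (chosen D j k)) τ)
    hn (fun m τ ⟨_, hτ⟩ => ⟨hτ.snd, hτ.size⟩) (fun m τ ⟨_, hτ⟩ => hτ.snd) ⟨l, ?_⟩
    (fun m hm τ ⟨l', hτ⟩ => ?_)
    (fun m τ ⟨l', hτ⟩ => ⟨l', hτ.set_snd (m + 1)⟩)) le_rfl (fun τ ⟨l', hτ⟩ => ⟨n, l', hτ⟩)
  · simpa using h.set_snd 0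
  · rw [append_flatMap_range_succ]
    exact hτ.loop_trd hn hj hm

theorem Inv.loop_fst (h : Inv D n j k l L σ) (hn : 1 ≤ n) :
    Runs (forLoop 1 (forLoop 2 (forLoop 3 tripleProg))) σ
      (n * (n * (n * (tripleProg.bound + 20) + 20) + 20))
      (fun τ => ∃ j' k' l', Inv D n j' k' l' (L ++ (List.range n).flatMap fun j =>
        (List.range n).flatMap fun k => (List.range n).flatMap (chosen D j k)) τ) := by
  refine Runs.mono (Runs.forLoop (n := n)
    (P := fun m τ => ∃ k' l', Inv D n m k' l' (L ++ (List.range m).flatMap fun j =>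
        (List.range n).flatMap fun k => (List.range n).flatMap (chosen D j k)) τ)
    (P' := fun m τ => ∃ k' l', Inv D n m k' l' (L ++ (List.range (m + 1)).flatMap fun j =>
        (List.range n).flatMap fun k => (List.range n).flatMap (chosen D j k)) τ)
    hn (fun m τ ⟨_, _, hτ⟩ => ⟨hτ.fst, hτ.size⟩) (fun m τ ⟨_, _, hτ⟩ => hτ.fst) ⟨k, l, ?_⟩
    (fun m hm τ ⟨k', l', hτ⟩ => ?_)
    (fun m τ ⟨k', l', hτ⟩ => ⟨k', l', hτ.set_fst (m + 1)⟩)) le_rfl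
    (fun τ ⟨k', l', hτ⟩ => ⟨n, k', l', hτ⟩)
  · simpa using h.set_fst 0
  · rw [append_flatMap_range_succ]
    exact hτ.loop_snd hn hm

/-- The output of the program. -/
def chosenList (D : ℕ → Datum) (n : ℕ) : List Alignment :=
  (List.range n).flatMap fun j => (List.range n).flatMap fun k =>
    (List.range n).flatMap (chosen D j k)

theorem mem_chosenList (a : Alignment) :
    a ∈ chosenList D n ↔ ∃ j k l : Fin n, j ≠ k ∧ a ∈ chosen D j k l := by
  simp only [chosenList, List.mem_flatMap, List.mem_range]
  constructor
  · rintro ⟨j, hj, k, hk, l, hl, ha⟩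
    refine ⟨⟨j, hj⟩, ⟨k, hk⟩, ⟨l, hl⟩, ?_, ha⟩
    intro h
    rw [chosen, if_pos (Fin.mk.inj h)] at ha
    exact List.not_mem_nil ha
  · rintro ⟨j, k, l, -, ha⟩
    exact ⟨j, j.2, k, k.2, l, l.2, ha⟩

/-- The datum in the `i`-th block of five cells. -/
def State.datum (σ : State) (i : ℕ) : Datum :=
  ⟨σ.mem (5 * i), σ.mem (5 * i + 1), σ.mem (5 * i + 2), σ.mem (5 * i + 3), σ.mem (5 * i + 4)⟩

theorem alignProg_runs (hn : 1 ≤ n) (hσ : σ.nat 0 = n) :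
    Runs alignProg σ ((tripleProg.bound + 100) * n ^ 3)
      (fun τ => HoldsOutput τ {a | a ∈ chosenList σ.datum n}) := by
  obtain ⟨N, R, M⟩ := σ
  -- The numbers 10 and 2 are the costs of the assignments before and after the loops; all lower
  -- powers of n are absorbed into n³.
  have hcost : 10 + (2 + (n * (n * (n * (tripleProg.bound + 20) + 20) + 20) + (10 + 2))) ≤
      (tripleProg.bound + 100) * n ^ 3 := by
    have h1 : 1 ≤ n ^ 3 := Nat.one_le_pow _ _ hn
    have h2 : n ≤ n ^ 3 := Nat.le_self_pow (by norm_num) n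
    have h3 : n ^ 2 ≤ n ^ 3 := Nat.pow_le_pow_right hn (by norm_num)
    nlinarith
  refine Runs.mono ?_ hcost fun τ h => h
  unfold alignProg
  refine Runs.seq' (Q := (· = _)) (Runs.setNat rfl) ?_
  rintro _ rfl
  refine Runs.seq' (Q := (· = _)) (Runs.setNat rfl) ?_
  rintro _ rfl
  have hinv : Inv (State.datum ⟨N, R, M⟩) n (N 1) (N 2) (N 3) []
      ⟨Function.update (Function.update N 4 (NExp.eval ⟨N, R, M⟩ (.five (.var 0)))) 5 0, R, M⟩ := by
    refine ⟨⟨?_, ?_, ?_, ?_, ?_⟩, ?_, ?_, ?_⟩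
    · simpa using hσ
    · simp
    · simp
    · simp
    · intro i _
      exact ⟨rfl, rfl, rfl, rfl, rfl⟩
    · simp only [NExp.eval_five, NExp.eval]
      simpa using hσ
    · simp
    · simp
  refine Runs.seq' (hinv.loop_fst hn) ?_
  rintro τ ⟨j, k, l, hτ⟩
  rw [List.nil_append] at hτ
  change Inv _ n j k l (chosenList _ n) τ at hτ
  -- The address 5n is computed first, while register 0 still holds n; only then does the length of
  -- the list replace it.
  refine Runs.seq' (Q := (· = _)) (Runs.setNat rfl) ?_
  rintro _ rfl
  refine Runs.setNat ?_
  have hlen : Function.update (Function.update τ.nat 1 (NExp.eval τ (.five (.var 0)))) 0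
      (NExp.eval { τ with nat := Function.update τ.nat 1 (NExp.eval τ (.five (.var 0))) }
        (.var 5)) 0 = (chosenList (State.datum ⟨N, R, M⟩) n).length := by
    simp [NExp.eval, hτ.count]
  have hptr : Function.update (Function.update τ.nat 1 (NExp.eval τ (.five (.var 0)))) 0
      (NExp.eval { τ with nat := Function.update τ.nat 1 (NExp.eval τ (.five (.var 0))) }
        (.var 5)) 1 = 5 * n := by
    simp [NExp.eval, NExp.eval_five, hτ.size]
  refine ⟨fun i => (chosenList (State.datum ⟨N, R, M⟩) n).get (Fin.cast hlen i), ?_, ?_⟩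
  · ext a
    simp only [Set.mem_ofPred_eq, Set.mem_range]
    rw [List.mem_iff_get]
    constructor
    · rintro ⟨i, rfl⟩
      exact ⟨Fin.cast hlen.symm i, rfl⟩
    · rintro ⟨i, rfl⟩
      exact ⟨_, rfl⟩
  · intro i
    have hi : (i : ℕ) < (chosenList (State.datum ⟨N, R, M⟩) n).length := (Fin.cast hlen i).2
    simp only [hptr]
    exact hτ.output i _ (List.getElem?_eq_getElem hi)

/-! ### The output of the program is an output of Align -/

/-- With both coefficients zero, the solution set would be the whole plane or empty, of dimension 2
or 0 instead of 1. -/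
theorem normal_ne_zero {ℓ : AffineSubspace ℝ Plane} (hℓ : IsLine ℓ) {α β γ : ℝ}
    (h : (ℓ : Set Plane) = {q | α * q 0 + β * q 1 = γ}) : 0 < α ^ 2 + β ^ 2 := by
  by_contra h0
  have hα : α = 0 := by nlinarith [sq_nonneg α, sq_nonneg β]
  have hβ : β = 0 := by nlinarith [sq_nonneg α, sq_nonneg β]
  subst hα hβ
  unfold IsLine at hℓ
  by_cases hγ : γ = 0
  · have : ℓ = ⊤ := by
      apply SetLike.coe_injective
      rw [h, hγ]
      ext q
      simp
    rw [this, AffineSubspace.direction_top, finrank_top, finrank_euclideanSpace,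
      Fintype.card_fin] at hℓ
    omega
  · have : ℓ = ⊥ := by
      apply SetLike.coe_injective
      rw [h]
      ext q
      simp [Ne.symm hγ]
    rw [this, AffineSubspace.direction_bot, finrank_bot] at hℓ
    omega

/-- Divide by the norm of the normal vector, with the sign that makes the right-hand side
nonnegative. The factor μ is kept so that the parallelism test can be transferred to the given
coefficients. -/
theorem exists_normalForm {p : Fin n → Plane} {ℓ : Fin n → AffineSubspace ℝ Plane}
    {E : Fin n → Datum} (hE : ∀ i, (E i).Describes (p i) (ℓ i)) :
    ∃ v b, IsNormalForm ℓ v b ∧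
      ∀ i, ∃ μ : ℝ, μ ≠ 0 ∧ v i 0 = μ * (E i).α ∧ v i 1 = μ * (E i).β := by
  have : ∀ i, ∃ (v : Plane) (b : ℝ), ‖v‖ = 1 ∧ 0 ≤ b ∧
      (ℓ i : Set Plane) = {q | inner ℝ v q = b} ∧
      ∃ μ : ℝ, μ ≠ 0 ∧ v 0 = μ * (E i).α ∧ v 1 = μ * (E i).β := by
    intro i
    obtain ⟨h0, -, -, hℓ⟩ := hE i
    generalize (E i).α = α at *
    generalize (E i).β = β at *
    generalize (E i).γ = γ at *
    have hρ : 0 < √(α ^ 2 + β ^ 2) := Real.sqrt_pos.2 h0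
    have hρ2 : √(α ^ 2 + β ^ 2) ^ 2 = α ^ 2 + β ^ 2 := Real.sq_sqrt h0.le
    obtain ⟨e, he, heγ⟩ : ∃ e : ℝ, e ^ 2 = 1 ∧ 0 ≤ e * γ := by
      rcases le_total 0 γ with h | h
      · exact ⟨1, by norm_num, by linarith⟩
      · exact ⟨-1, by norm_num, by linarith⟩
    have he0 : e ≠ 0 := by rintro rfl; norm_num at he
    set ρ := √(α ^ 2 + β ^ 2)
    refine ⟨!₂[e * α / ρ, e * β / ρ], e * γ / ρ, ?_, by positivity, ?_, e / ρ, div_ne_zero he0 hρ.ne',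
      mul_div_right_comm _ _ _, mul_div_right_comm _ _ _⟩
    · rw [norm_eq_one_iff]
      simp only [Matrix.cons_val_zero, Matrix.cons_val_one]
      rw [div_pow, div_pow, ← add_div, hρ2, div_eq_one_iff_eq h0.ne']
      linear_combination (α ^ 2 + β ^ 2) * he
    · rw [hℓ]
      ext q
      simp only [Set.mem_ofPred_eq, inner_eq, Matrix.cons_val_zero, Matrix.cons_val_one]
      rw [div_mul_eq_mul_div, div_mul_eq_mul_div, ← add_div, div_left_inj' hρ.ne', mul_assoc,
        mul_assoc, ← mul_add, mul_right_inj' he0]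
  choose v b h using this
  exact ⟨v, b, fun i => ⟨(h i).1, (h i).2.1, (h i).2.2.1⟩, fun i => (h i).2.2.2⟩

/-- The program never normalizes the equations: the crossing and sliding sets are the same for any
describing data, and determinants only acquire nonzero factors. -/
theorem isAlignOutput_chosenList {p : Fin n → Plane} {ℓ : Fin n → AffineSubspace ℝ Plane}
    (hD : ∀ i : Fin n, (D i).Describes (p i) (ℓ i)) :
    IsAlignOutput p ℓ {a | a ∈ chosenList D n} := by
  obtain ⟨v, b, hnf, hμ⟩ := exists_normalForm hD
  have hdet : ∀ j k : Fin n, |inner ℝ (v j) (v k)| = 1 ↔ (D j).det (D k) = 0 := by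
    intro j k
    rw [hnf.abs_inner_eq_one_iff]
    obtain ⟨μ, hμ0, h0, h1⟩ := hμ j
    obtain ⟨ν, hν0, h2, h3⟩ := hμ k
    have e : v j 0 * v k 1 - v k 0 * v j 1 = μ * ν * (D j).det (D k) := by
      rw [h0, h1, h2, h3, Datum.det]
      ring
    rw [e, mul_eq_zero, or_iff_right (mul_ne_zero hμ0 hν0)]
  refine ⟨v, b, fun j k l => {a | a ∈ chosen D j k l}, hnf, ?_, ?_, ?_⟩
  · intro j k l hjk h
    rw [hnf.crossing_eq h hD l]
    have h' := mt (hdet j k).2 h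
    convert Frame.isSelection_best (d₃ := D l) h' using 1
    ext a
    simp [chosen, if_neg h', Fin.val_inj, hjk]
  · intro j k l hjk h
    rw [Datum.sliding_eq hD]
    have h' := (hdet j k).1 h
    convert Frame.isSelectionPerRotation_best (hD j).1 h' using 1
    ext a
    simp [chosen, if_pos h', Fin.val_inj, hjk]
  · ext a
    exact mem_chosenList a

end PointsToLines

/-! ### Assembly of the guarantee and the program. -/

theorem mainTheorem2 :
    ∃ K : ℕ,
      (∀ (n : ℕ), 3 ≤ n →
        ∀ (p : Fin n → PointsToLines.Plane) (ℓ : Fin n → AffineSubspace ℝ PointsToLines.Plane),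
          (∀ i, PointsToLines.IsLine (ℓ i)) →
          ∀ C : Set PointsToLines.Alignment, PointsToLines.IsAlignOutput p ℓ C →
            (∀ a' : PointsToLines.Alignment, ∃ a ∈ C, ∀ i,
              PointsToLines.lineDist (a.app (p i)) (ℓ i) ≤
                16 * PointsToLines.lineDist (a'.app (p i)) (ℓ i)) ∧
            C.Finite ∧ C.ncard ≤ K * n ^ 3) ∧
      (∃ c : PointsToLines.Prog, ∀ (n : ℕ), 3 ≤ n →
        ∀ (p : Fin n → PointsToLines.Plane) (ℓ : Fin n → AffineSubspace ℝ PointsToLines.Plane),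
          (∀ i, PointsToLines.IsLine (ℓ i)) →
          ∀ σ : PointsToLines.State, PointsToLines.HoldsInput σ p ℓ →
            ∃ (k : ℕ) (σ' : PointsToLines.State) (C : Set PointsToLines.Alignment),
              PointsToLines.Exec c σ k σ' ∧ k ≤ K * n ^ 3 ∧
              PointsToLines.IsAlignOutput p ℓ C ∧ PointsToLines.HoldsOutput σ' C) := by
  refine ⟨PointsToLines.tripleProg.bound + 100, ?_, PointsToLines.alignProg, ?_⟩
  · intro n hn p ℓ _ C hC
    obtain ⟨h1, h2, h3⟩ := hC.guarantee (by omega)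
    exact ⟨h1, h2, h3.trans (Nat.mul_le_mul_right _ (by omega))⟩
  · rintro n hn p ℓ hℓ σ ⟨hσ, hin⟩
    obtain ⟨k, σ', he, hk, hout⟩ := PointsToLines.alignProg_runs (σ := σ) (by omega) hσ
    refine ⟨k, σ', _, he, hk, PointsToLines.isAlignOutput_chosenList fun i => ?_, hout⟩
    obtain ⟨h0, h1, h2⟩ := hin i
    exact ⟨PointsToLines.normal_ne_zero (hℓ i) h2, h0, h1, h2⟩
end
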